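/- Let $k$ be a field, let $W$ be a finite group, and let $P$ be a locally finite poset on which $W$ acts by order automorphisms. Let $\mathcal C^W(P)$ be the category whose objects are families $V=(V_{xy})_{x\le y\in P}$ of finite-dimensional $k$-vector spaces together with linear maps $\varphi^\sigma_{xy}:V_{xy}\to V_{\sigma(x)\sigma(y)}$ for $\sigma\in W$, $x\le y$, such that $\varphi^e_{xy}=\mathrm{id}$ and $\varphi^{\sigma'}_{\sigma(x)\sigma(y)}\circ\varphi^{\sigma}_{xy}=\varphi^{\sigma'\sigma}_{xy}$; morphisms are families of linear maps commuting with the $\varphi^\sigma_{xy}$. Put $(U\otimes V)_{xz}=\bigoplus_{x\le y\le z}U_{xy}\otimes V_{yz}$. The equivariant incidence algebra $I^W(P)$ is the Grothendieck ring of $\mathcal C^W(P)$: it is generated as an abelian group by the classes $[V]$, with relations $[V]=[V']+[V'']$ for the short exact sequences $0\to V'\to V\to V''\to 0$, and $[U][V]=[U\otimes V]$. Its unit $\delta$ is the class of the object with the trivial one-dimensional representation at each $(x,x)$ and $0$ at $(x,y)$ for $x<y$. For $x\le y$ let $W_{xy}$ be the subgroup of $W$ fixing both $x$ and $y$, let $\mathrm{VRep}(W_{xy})$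 be the Grothendieck group of its finite-dimensional representations over $k$, and let $f\mapsto f_{xy}\in\mathrm{VRep}(W_{xy})$ be the map $[V]\mapsto[V_{xy}]$ on $I^W(P)$. Let $r$ be a $W$-invariant weak rank function on $P$, that is, a collection of natural numbers $r_{xy}$, $x\le y$, with $r_{xy}>0$ for $x<y$, $r_{xy}+r_{yz}=r_{xz}$ for $x\le y\le z$, and $r_{\sigma(x)\sigma(y)}=r_{xy}$ for $\sigma\in W$. For a formal power series $f=\sum_n f_n t^n$ with $f_n\in I^W(P)$ put $f_{xy}(t)=\sum_n (f_n)_{xy}t^n$. Let $\mathscr I^W(P)$ be the set of those $f$ for which each $f_{xy}(t)$ is a polynomial of degree at most $r_{xy}$, and let $\mathscr I^W_{1/2}(P)$ be the set of those $f$ for which $f_{xx}(t)=\delta_{xx}$ for all $x$ and $f_{xy}(t)$ is a polynomial of degree $<r_{xy}/2$ for all $x<y$. (The degrees of the polynomials $f_{xy}(t)$ need not be bounded uniformly in $x\le y$; when $r$ is bounded, these are subsets of $I^W(P)\otimes\mathbb Z[t]$.) For $f\in\mathscr I^W(P)$ let $\bar f\in\mathscr I^W(P)$ be the element with $\bar f_{xy}(t)=t^{r_{xy}}f_{xy}(t^{-1})$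 for all $x\le y$. An element $\kappa\in\mathscr I^W(P)$ is a $P$-kernel if $\kappa_{xx}(t)=\delta_{xx}$ for all $x\in P$ and $\bar\kappa=\kappa^{-1}$. **Theorem.** If $\kappa\in\mathscr I^W(P)$ is a $P$-kernel, then there exists a unique pair $f,g\in\mathscr I^W_{1/2}(P)$ such that $\bar f=\kappa f$ and $\bar g=g\kappa$. -/

import Mathlib

open scoped TensorProduct DirectSum

noncomputable section

universe t u v w x

/-! ### Equivariant families of finite dimensional vector spaces -/

/-- For a group `G` acting on a set `X`: a family of finite dimensional `k`-vector spaces `V p`,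
`p ∈ X`, with an action of `G` compatible with the action on `X`. The map `act σ h` is the map
`φ^σ_p : V p → V (σ p)`; the target is given as `V q` with a proof `h : σ • p = q`.
For a one-point set `X` this is a finite dimensional representation of `G`. -/
structure EqFam (k : Type u) (G : Type w) (X : Type x) [Field k] [Group G] [MulAction G X] where
  V : X → Type t
  [acg : ∀ p, AddCommGroup (V p)]
  [mod : ∀ p, Module k (V p)]
  [fin : ∀ p, FiniteDimensional k (V p)]
  act : ∀ (σ : G) {p q : X}, σ • p = q → (V p →ₗ[k] V q)
  act_one : ∀ (p : X) (h : (1 : G) • p = p) (a : V p), act 1 h a = a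
  act_mul : ∀ (τ σ : G) {p q r : X} (h : σ • p = q) (h' : τ • q = r) (h'' : (τ * σ) • p = r)
    (a : V p), act τ h' (act σ h a) = act (τ * σ) h'' a

attribute [instance] EqFam.acg EqFam.mod EqFam.fin

namespace EqFam

variable {k : Type u} {G : Type w} {X : Type x} [Field k] [Group G] [MulAction G X]

/-- Morphisms: linear maps compatible with the decomposition and with the action. -/
structure Hom (A B : EqFam.{t} k G X) where
  map : ∀ p, A.V p →ₗ[k] B.V p
  comm : ∀ (σ : G) {p q : X} (h : σ • p = q) (a : A.V p),
    map q (A.act σ h a) = B.act σ h (map p a)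

/-- `0 → A → B → C → 0` is exact. -/
def IsShortExact {A B C : EqFam.{t} k G X} (i : Hom A B) (j : Hom B C) : Prop :=
  ∀ p, Function.Injective (i.map p) ∧ Function.Exact (i.map p) (j.map p) ∧
    Function.Surjective (j.map p)

/-- The zero object. -/
def zero : EqFam.{t} k G X where
  V _ := PUnit
  act _ _ _ _ := 0
  act_one _ _ _ := rfl
  act_mul _ _ _ _ _ _ _ _ _ := rfl

/-- The representation of a subgroup `H` fixing `p` on the member `V p` of a family. -/
def fiber (A : EqFam.{t} k G X) (p : X) (H : Subgroup G) (hH : ∀ σ ∈ H, σ • p = p) :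
    EqFam.{t} k H PUnit.{1} where
  V _ := A.V p
  act σ _ _ _ := A.act (σ : G) (hH σ σ.2)
  act_one _ _ a := A.act_one p _ a
  act_mul τ σ _ _ _ _ _ _ a := A.act_mul (τ : G) (σ : G) _ _ _ a

/-- The relations `[B] = [A] + [C]` of the Grothendieck group, one for each short exact sequence. -/
def relations (k : Type u) (G : Type w) (X : Type x) [Field k] [Group G] [MulAction G X] :
    Set (FreeAbelianGroup (EqFam.{t} k G X)) :=
  {z | ∃ (A B C : EqFam.{t} k G X) (i : Hom A B) (j : Hom B C), IsShortExact i j ∧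
    z = FreeAbelianGroup.of B - (FreeAbelianGroup.of A + FreeAbelianGroup.of C)}

end EqFam

/-- The Grothendieck group of the abelian category of `G`-equivariant families over `X`. -/
def K0 (k : Type u) (G : Type w) (X : Type x) [Field k] [Group G] [MulAction G X] :
    Type (max (t + 1) u w x) :=
  FreeAbelianGroup (EqFam.{t} k G X) ⧸ AddSubgroup.closure (EqFam.relations.{t} k G X)

namespace K0

variable {k : Type u} {G : Type w} {X : Type x} [Field k] [Group G] [MulAction G X]

instance : AddCommGroup (K0.{t} k G X) :=
  inferInstanceAs
    (AddCommGroup (FreeAbelianGroup (EqFam.{t} k G X) ⧸ AddSubgroup.closure (EqFam.relations k G X)))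

/-- The class of an object. -/
def cls (A : EqFam.{t} k G X) : K0.{t} k G X :=
  QuotientAddGroup.mk (FreeAbelianGroup.of A)

/-- The universal property of the Grothendieck group. -/
def lift {M : Type*} [AddCommGroup M] (F : EqFam.{t} k G X → M)
    (hF : ∀ (A B C : EqFam.{t} k G X) (i : EqFam.Hom A B) (j : EqFam.Hom B C), EqFam.IsShortExact i j →
      F B = F A + F C) : K0.{t} k G X →+ M :=
  QuotientAddGroup.lift _ (FreeAbelianGroup.lift F) (by
    rw [AddSubgroup.closure_le]
    rintro z ⟨A, B, C, i, j, h, rfl⟩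
    simp [hF A B C i j h])

@[simp] theorem lift_cls {M : Type*} [AddCommGroup M] (F : EqFam.{t} k G X → M) (hF)
    (A : EqFam.{t} k G X) : lift F hF (cls A) = F A := by
  exact (QuotientAddGroup.lift_mk _ _ _).trans (FreeAbelianGroup.lift_apply_of _ _)

theorem cls_exact {A B C : EqFam.{t} k G X} (i : EqFam.Hom A B) (j : EqFam.Hom B C) (h : EqFam.IsShortExact i j) :
    cls B = cls A + cls C := by
  have : (QuotientAddGroup.mk (FreeAbelianGroup.of B -
      (FreeAbelianGroup.of A + FreeAbelianGroup.of C)) : K0.{t} k G X) = 0 :=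
    (QuotientAddGroup.eq_zero_iff _).2 (AddSubgroup.subset_closure ⟨A, B, C, i, j, h, rfl⟩)
  exact sub_eq_zero.1 this

theorem induction {motive : K0.{t} k G X → Prop} (z : K0.{t} k G X) (zero : motive 0)
    (cls : ∀ A, motive (cls A)) (add : ∀ a b, motive a → motive b → motive (a + b))
    (neg : ∀ a, motive a → motive (-a)) : motive z := by
  induction z using QuotientAddGroup.induction_on with
  | H z =>
    induction z using FreeAbelianGroup.induction_on with
    | zero => exact zero
    | of A => exact cls A
    | neg A h => exact neg _ h
    | add a b ha hb => exact add _ _ ha hb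

theorem cls_zero : cls (EqFam.zero : EqFam.{t} k G X) = 0 := by
  have h := cls_exact (A := EqFam.zero) (B := EqFam.zero) (C := (EqFam.zero : EqFam.{t} k G X))
    ⟨fun _ => 0, fun _ _ _ _ _ => rfl⟩ ⟨fun _ => 0, fun _ _ _ _ _ => rfl⟩
    (fun p => ⟨fun _ _ _ => rfl, fun y => ⟨fun _ => ⟨y, rfl⟩, fun _ => rfl⟩, fun y => ⟨y, rfl⟩⟩)
  simpa using h

/-- Isomorphic objects have the same class. -/
theorem cls_eq_of_bijective {A B : EqFam.{t} k G X} (f : EqFam.Hom A B)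
    (hf : ∀ p, Function.Bijective (f.map p)) : cls A = cls B := by
  have h := cls_exact (A := A) (B := B) (C := EqFam.zero) f
    ⟨fun _ => 0, fun _ _ _ _ _ => rfl⟩
    (fun p => ⟨(hf p).1, fun y => ⟨fun _ => (hf p).2 y, fun _ => rfl⟩, fun y => ⟨0, rfl⟩⟩)
  rw [h, cls_zero, add_zero]

/-- Restriction to the member at `p`, as a virtual representation of a subgroup fixing `p`. -/
def fiber (p : X) (H : Subgroup G) (hH : ∀ σ ∈ H, σ • p = p) :
    K0.{t} k G X →+ K0.{t} k H PUnit.{1} :=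
  lift (fun A => cls (A.fiber p H hH)) (fun _ _ _ i j h =>
    cls_exact (⟨fun _ => i.map p, fun σ _ _ _ a => i.comm (σ : G) (hH σ σ.2) a⟩)
      (⟨fun _ => j.map p, fun σ _ _ _ a => j.comm (σ : G) (hH σ σ.2) a⟩) (fun _ => h p))

end K0

/-- The group of finite dimensional virtual representations of `G` over `k`. -/
abbrev VRep (k : Type u) (G : Type w) [Field k] [Group G] : Type (max (t + 1) u w) :=
  K0.{t} k G PUnit.{1}

/-! ### Intervals of a poset with symmetries -/

/-- Pairs `x ≤ y` in `P`. -/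
@[ext]
structure Intv (P : Type v) [PartialOrder P] where
  lo : P
  hi : P
  le : lo ≤ hi

/-- The group `W` acts on the poset `P` by order automorphisms. -/
class PosetAction (W : Type w) (P : Type v) [Group W] [PartialOrder P] extends MulAction W P where
  smul_mono : ∀ (σ : W) {x y : P}, x ≤ y → σ • x ≤ σ • y

section

variable {k : Type u} {W : Type w} {P : Type v} [Field k] [Group W] [PartialOrder P]
  [PosetAction W P]

instance : MulAction W (Intv P) where
  smul σ p := ⟨σ • p.lo, σ • p.hi, PosetAction.smul_mono σ p.le⟩
  one_smul p := Intv.ext (one_smul W p.lo) (one_smul W p.hi)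
  mul_smul σ τ p := Intv.ext (mul_smul σ τ p.lo) (mul_smul σ τ p.hi)

theorem Intv.smul_lo (σ : W) (p : Intv P) : (σ • p).lo = σ • p.lo := rfl

theorem Intv.smul_hi (σ : W) (p : Intv P) : (σ • p).hi = σ • p.hi := rfl

variable (W) in
/-- The group `W_{xy} = W_x ∩ W_y`. -/
abbrev Intv.stab (p : Intv P) : Subgroup W :=
  MulAction.stabilizer W p.lo ⊓ MulAction.stabilizer W p.hi

theorem Intv.stab_smul (p : Intv P) (σ : W) (h : σ ∈ p.stab W) : σ • p = p :=
  Intv.ext h.1 h.2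

/-- The interval `[x, y]` for `y ∈ [x, z]`. -/
abbrev Intv.left (p : Intv P) (y : Set.Icc p.lo p.hi) : Intv P := ⟨p.lo, y, y.2.1⟩

/-- The interval `[y, z]` for `y ∈ [x, z]`. -/
abbrev Intv.right (p : Intv P) (y : Set.Icc p.lo p.hi) : Intv P := ⟨y, p.hi, y.2.2⟩

/-- The action of `σ` as a map `[x, z] → [σ x, σ z]`. -/
abbrev Intv.move {p q : Intv P} (σ : W) (h : σ • p = q) (y : Set.Icc p.lo p.hi) :
    Set.Icc q.lo q.hi :=
  ⟨σ • (y : P), by subst h; exact ⟨PosetAction.smul_mono σ y.2.1, PosetAction.smul_mono σ y.2.2⟩⟩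

theorem Intv.move_left {p q : Intv P} (σ : W) (h : σ • p = q) (y : Set.Icc p.lo p.hi) :
    σ • p.left y = q.left (Intv.move σ h y) := by subst h; rfl

theorem Intv.move_right {p q : Intv P} (σ : W) (h : σ • p = q) (y : Set.Icc p.lo p.hi) :
    σ • p.right y = q.right (Intv.move σ h y) := by subst h; rfl

namespace EqFam

theorem act_congr (A : EqFam.{t} k W (Intv P)) {σ τ : W} (e : σ = τ) {p q : Intv P}
    (h : σ • p = q) (h' : τ • p = q) (a : A.V p) : A.act σ h a = A.act τ h' a := by
  subst e; rfl

open Classical in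
/-- The map `(U ⊗ V)_p → (U ⊗ V)_{σ p}` induced by the actions on `U` and `V`. -/
def tensorAct (A B : EqFam.{t} k W (Intv P)) (σ : W) {p q : Intv P} (h : σ • p = q) :
    (⨁ y : Set.Icc p.lo p.hi, A.V (p.left y) ⊗[k] B.V (p.right y)) →ₗ[k]
      ⨁ y : Set.Icc q.lo q.hi, A.V (q.left y) ⊗[k] B.V (q.right y) :=
  DirectSum.toModule k _ _ fun y =>
    (DirectSum.lof k _ (fun y => A.V (q.left y) ⊗[k] B.V (q.right y)) (Intv.move σ h y)).comp
      (TensorProduct.map (A.act σ (Intv.move_left σ h y)) (B.act σ (Intv.move_right σ h y)))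

open Classical in
theorem tensorAct_lof (A B : EqFam.{t} k W (Intv P)) (σ : W) {p q : Intv P} (h : σ • p = q)
    (y : Set.Icc p.lo p.hi) (a : A.V (p.left y)) (b : B.V (p.right y)) :
    tensorAct A B σ h (DirectSum.lof k _ (fun y => A.V (p.left y) ⊗[k] B.V (p.right y)) y
      (a ⊗ₜ b)) =
    DirectSum.lof k _ (fun y => A.V (q.left y) ⊗[k] B.V (q.right y)) (Intv.move σ h y)
      (A.act σ (Intv.move_left σ h y) a ⊗ₜ B.act σ (Intv.move_right σ h y) b) := by
  simp [tensorAct]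

open Classical in
/-- Equal indices: the summands are identified through the action of the identity. -/
theorem lof_congr (A B : EqFam.{t} k W (Intv P)) {q : Intv P} {y z : Set.Icc q.lo q.hi}
    (h : y = z) {p p' : Intv P} (σ τ : W) (e : σ = τ) (a : A.V p) (b : B.V p')
    (h1 : σ • p = q.left y) (h2 : τ • p = q.left z)
    (h3 : σ • p' = q.right y) (h4 : τ • p' = q.right z) :
    DirectSum.lof k _ (fun y => A.V (q.left y) ⊗[k] B.V (q.right y)) y
      (A.act σ h1 a ⊗ₜ B.act σ h3 b) =
    DirectSum.lof k _ (fun y => A.V (q.left y) ⊗[k] B.V (q.right y)) z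
      (A.act τ h2 a ⊗ₜ B.act τ h4 b) := by
  subst h; subst e; rfl

variable [LocallyFiniteOrder P]

open Classical in
/-- The tensor product `(U ⊗ V)_{xz} = ⨁_{x ≤ y ≤ z} U_{xy} ⊗ V_{yz}`. -/
def tensor (A B : EqFam.{max u v} k W (Intv P)) : EqFam.{max u v} k W (Intv P) where
  V p := ⨁ y : Set.Icc p.lo p.hi, A.V (p.left y) ⊗[k] B.V (p.right y)
  act σ _ _ h := tensorAct A B σ h
  act_one p h a := by
    suffices H : tensorAct A B 1 h = LinearMap.id from LinearMap.congr_fun H a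
    refine DirectSum.linearMap_ext _ fun y => TensorProduct.ext' fun a b => ?_
    have h1 : (1 : W) • p.left y = p.left y := one_smul _ _
    have h2 : (1 : W) • p.right y = p.right y := one_smul _ _
    simp only [LinearMap.comp_apply, tensorAct_lof, LinearMap.id_apply]
    rw [lof_congr A B (z := y) (Subtype.ext (one_smul W (y : P))) 1 1 rfl a b _ h1 _ h2,
      A.act_one, B.act_one]
  act_mul τ σ p q r h h' h'' a := by
    suffices H : (tensorAct A B τ h').comp (tensorAct A B σ h) = tensorAct A B (τ * σ) h'' from
      LinearMap.congr_fun H a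
    refine DirectSum.linearMap_ext _ fun y => TensorProduct.ext' fun a b => ?_
    simp only [LinearMap.comp_apply, tensorAct_lof]
    have e : Intv.move τ h' (Intv.move σ h y) = Intv.move (τ * σ) h'' y :=
      Subtype.ext (mul_smul τ σ (y : P)).symm
    rw [A.act_mul τ σ _ _ ((Intv.move_left _ h'' y).trans (by rw [e])),
      B.act_mul τ σ _ _ ((Intv.move_right _ h'' y).trans (by rw [e]))]
    exact lof_congr A B e _ _ rfl a b _ _ _ _

/-- The unit object: the trivial representation on the intervals `[x, x]`, and zero elsewhere. -/
def unit : EqFam.{max u v} k W (Intv P) where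
  V p := ULift.{v} (PLift (p.lo = p.hi)) → k
  act σ _ _ h := LinearMap.funLeft k k fun e =>
    ⟨⟨by subst h; exact MulAction.injective σ e.down.down⟩⟩
  act_one _ _ _ := rfl
  act_mul _ _ _ _ _ _ _ _ _ := rfl


/-- Naturality of the tensor product. -/
def tensorMap {A B C D : EqFam.{max u v} k W (Intv P)} (f : Hom A B) (g : Hom C D) :
    Hom (A.tensor C) (B.tensor D) where
  map p := DirectSum.lmap fun y => TensorProduct.map (f.map (p.left y)) (g.map (p.right y))
  comm σ p q h a := by
    classical
    suffices H : (DirectSum.lmap fun y => TensorProduct.map (f.map (q.left y))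
        (g.map (q.right y))).comp (tensorAct A C σ h) =
        (tensorAct B D σ h).comp (DirectSum.lmap fun y => TensorProduct.map (f.map (p.left y))
        (g.map (p.right y))) from LinearMap.congr_fun H a
    refine DirectSum.linearMap_ext _ fun y => TensorProduct.ext' fun a b => ?_
    simp only [LinearMap.comp_apply, tensorAct_lof, DirectSum.lmap_lof, TensorProduct.map_tmul,
      f.comm, g.comm]

theorem lmap_exact {ι : Type*} [Finite ι] {M N L : ι → Type*} [∀ i, AddCommGroup (M i)]
    [∀ i, AddCommGroup (N i)] [∀ i, AddCommGroup (L i)] [∀ i, Module k (M i)]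
    [∀ i, Module k (N i)] [∀ i, Module k (L i)] (f : ∀ i, M i →ₗ[k] N i) (g : ∀ i, N i →ₗ[k] L i)
    (h : ∀ i, Function.Exact (f i) (g i)) :
    Function.Exact (DirectSum.lmap f) (DirectSum.lmap g) := by
  classical
  have := Fintype.ofFinite ι
  intro z
  constructor
  · intro hz
    have hz' : ∀ i, g i (z i) = 0 := fun i => by rw [← DirectSum.lmap_apply, hz]; rfl
    choose m hm using fun i => (h i (z i)).1 (hz' i)
    refine ⟨(DirectSum.linearEquivFunOnFintype k ι M).symm m, ?_⟩
    ext i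
    rw [DirectSum.lmap_apply, ← hm i]
    exact congrArg _ <| congrFun ((DirectSum.linearEquivFunOnFintype k ι M).apply_symm_apply m) i
  · rintro ⟨m, rfl⟩
    ext i
    rw [DirectSum.lmap_apply, DirectSum.lmap_apply]
    exact (h i).apply_apply_eq_zero (m i)

def Hom.id (A : EqFam.{t} k W (Intv P)) : Hom A A := ⟨fun _ => LinearMap.id, fun _ _ _ _ _ => rfl⟩

theorem tensor_exact_left (U : EqFam.{max u v} k W (Intv P)) {A B C : EqFam.{max u v} k W (Intv P)}
    (i : Hom A B) (j : Hom B C) (h : IsShortExact i j) :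
    IsShortExact (tensorMap (Hom.id U) i) (tensorMap (Hom.id U) j) := fun p =>
  ⟨(DirectSum.lmap_injective _).2 fun y =>
      Module.Flat.lTensor_preserves_injective_linearMap _ (h (p.right y)).1,
    lmap_exact _ _ fun y => lTensor_exact _ (h (p.right y)).2.1 (h (p.right y)).2.2,
    (DirectSum.lmap_surjective _).2 fun y => LinearMap.lTensor_surjective _ (h (p.right y)).2.2⟩

theorem tensor_exact_right (U : EqFam.{max u v} k W (Intv P)) {A B C : EqFam.{max u v} k W (Intv P)}
    (i : Hom A B) (j : Hom B C) (h : IsShortExact i j) :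
    IsShortExact (tensorMap i (Hom.id U)) (tensorMap j (Hom.id U)) := fun p =>
  ⟨(DirectSum.lmap_injective _).2 fun y =>
      Module.Flat.rTensor_preserves_injective_linearMap _ (h (p.left y)).1,
    lmap_exact _ _ fun y => rTensor_exact _ (h (p.left y)).2.1 (h (p.left y)).2.2,
    (DirectSum.lmap_surjective _).2 fun y => LinearMap.rTensor_surjective _ (h (p.left y)).2.2⟩

/-! The associativity and unit isomorphisms. -/

open Classical in
/-- The element `a ⊗ b` of the summand of `(A ⊗ B)_{xz}` with index `y`. -/
def pure (A B : EqFam.{max u v} k W (Intv P)) (p : Intv P) (y : Set.Icc p.lo p.hi) :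
    A.V (p.left y) ⊗[k] B.V (p.right y) →ₗ[k] (A.tensor B).V p :=
  DirectSum.lof k _ (fun y => A.V (p.left y) ⊗[k] B.V (p.right y)) y

theorem pure_ext {A B : EqFam.{max u v} k W (Intv P)} {p : Intv P} {M : Type*} [AddCommGroup M]
    [Module k M] {f g : (A.tensor B).V p →ₗ[k] M}
    (h : ∀ y a b, f (pure A B p y (a ⊗ₜ b)) = g (pure A B p y (a ⊗ₜ b))) : f = g := by
  classical
  exact DirectSum.linearMap_ext _ fun y => TensorProduct.ext' fun a b => h y a b

open Classical in
/-- The map out of `(A ⊗ B)_{xz}` with given restrictions to the summands. -/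
def desc {A B : EqFam.{max u v} k W (Intv P)} {p : Intv P} {M : Type*} [AddCommGroup M]
    [Module k M] (f : ∀ y : Set.Icc p.lo p.hi, A.V (p.left y) ⊗[k] B.V (p.right y) →ₗ[k] M) :
    (A.tensor B).V p →ₗ[k] M :=
  DirectSum.toModule k _ _ f

theorem desc_pure {A B : EqFam.{max u v} k W (Intv P)} {p : Intv P} {M : Type*} [AddCommGroup M]
    [Module k M] (f : ∀ y : Set.Icc p.lo p.hi, A.V (p.left y) ⊗[k] B.V (p.right y) →ₗ[k] M)
    (y) (a) : desc f (pure A B p y a) = f y a := by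
  classical
  exact DirectSum.toModule_lof k _ _

theorem act_pure (A B : EqFam.{max u v} k W (Intv P)) (σ : W) {p q : Intv P} (h : σ • p = q)
    (y : Set.Icc p.lo p.hi) (a : A.V (p.left y)) (b : B.V (p.right y)) :
    (A.tensor B).act σ h (pure A B p y (a ⊗ₜ b)) = pure A B q (Intv.move σ h y)
      (A.act σ (Intv.move_left σ h y) a ⊗ₜ B.act σ (Intv.move_right σ h y) b) :=
  tensorAct_lof A B σ h y a b

section coherence

variable (A B C : EqFam.{max u v} k W (Intv P))

theorem pure_ext₁ {p : Intv P} {M : Type*} [AddCommGroup M] [Module k M]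
    {f g : ((A.tensor B).tensor C).V p →ₗ[k] M}
    (h : ∀ z y a b c, f (pure (A.tensor B) C p z (pure A B (p.left z) y (a ⊗ₜ b) ⊗ₜ c)) =
      g (pure (A.tensor B) C p z (pure A B (p.left z) y (a ⊗ₜ b) ⊗ₜ c))) : f = g := by
  refine pure_ext fun z d c => ?_
  have : f ∘ₗ pure (A.tensor B) C p z ∘ₗ (TensorProduct.mk k _ _).flip c =
      g ∘ₗ pure (A.tensor B) C p z ∘ₗ (TensorProduct.mk k _ _).flip c :=
    pure_ext fun y a b => h z y a b c
  exact LinearMap.congr_fun this d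

theorem pure_ext₂ {p : Intv P} {M : Type*} [AddCommGroup M] [Module k M]
    {f g : (A.tensor (B.tensor C)).V p →ₗ[k] M}
    (h : ∀ y z a b c, f (pure A (B.tensor C) p y (a ⊗ₜ pure B C (p.right y) z (b ⊗ₜ c))) =
      g (pure A (B.tensor C) p y (a ⊗ₜ pure B C (p.right y) z (b ⊗ₜ c)))) : f = g := by
  refine pure_ext fun y a d => ?_
  have : f ∘ₗ pure A (B.tensor C) p y ∘ₗ TensorProduct.mk k _ _ a =
      g ∘ₗ pure A (B.tensor C) p y ∘ₗ TensorProduct.mk k _ _ a :=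
    pure_ext fun z b c => h y z a b c
  exact LinearMap.congr_fun this d

def assocFun (p : Intv P) :
    ((A.tensor B).tensor C).V p →ₗ[k] (A.tensor (B.tensor C)).V p :=
  desc fun z => TensorProduct.lift <| desc fun y => TensorProduct.curry <|
    let y' : Set.Icc p.lo p.hi := ⟨y, y.2.1, y.2.2.trans z.2.2⟩
    let z' : Set.Icc (y : P) p.hi := ⟨z, y.2.2, z.2.2⟩
    pure A (B.tensor C) p y' ∘ₗ
      LinearMap.lTensor (A.V (p.left y')) (pure B C (p.right y') z') ∘ₗ
      (TensorProduct.assoc k (A.V (p.left y')) (B.V ((p.right y').left z'))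
        (C.V ((p.right y').right z'))).toLinearMap

def assocInv (p : Intv P) :
    (A.tensor (B.tensor C)).V p →ₗ[k] ((A.tensor B).tensor C).V p :=
  desc fun y => TensorProduct.lift <| LinearMap.flip <| desc fun z => LinearMap.flip <|
    TensorProduct.curry <|
    let z' : Set.Icc p.lo p.hi := ⟨z, y.2.1.trans z.2.1, z.2.2⟩
    let y' : Set.Icc p.lo (z : P) := ⟨y, y.2.1, z.2.1⟩
    pure (A.tensor B) C p z' ∘ₗ
      LinearMap.rTensor (C.V (p.right z')) (pure A B (p.left z') y') ∘ₗ
      (TensorProduct.assoc k (A.V ((p.left z').left y')) (B.V ((p.left z').right y'))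
        (C.V (p.right z'))).symm.toLinearMap

theorem assocFun_pure (p : Intv P) (z y a b c) :
    assocFun A B C p (pure (A.tensor B) C p z (pure A B (p.left z) y (a ⊗ₜ b) ⊗ₜ c)) =
      pure A (B.tensor C) p ⟨y, y.2.1, y.2.2.trans z.2.2⟩
        (a ⊗ₜ pure B C ⟨y, p.hi, y.2.2.trans z.2.2⟩ ⟨z, y.2.2, z.2.2⟩ (b ⊗ₜ c)) := by
  rw [assocFun, desc_pure, TensorProduct.lift.tmul, desc_pure]
  rfl

theorem assocInv_pure (p : Intv P) (y z a b c) :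
    assocInv A B C p (pure A (B.tensor C) p y (a ⊗ₜ pure B C (p.right y) z (b ⊗ₜ c))) =
      pure (A.tensor B) C p ⟨z, y.2.1.trans z.2.1, z.2.2⟩
        (pure A B ⟨p.lo, z, y.2.1.trans z.2.1⟩ ⟨y, y.2.1, z.2.1⟩ (a ⊗ₜ b) ⊗ₜ c) := by
  rw [assocInv, desc_pure, TensorProduct.lift.tmul, LinearMap.flip_apply, desc_pure]
  rfl

/-- The associativity isomorphism. -/
def assocHom : Hom ((A.tensor B).tensor C) (A.tensor (B.tensor C)) where
  map p := assocFun A B C p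
  comm σ p q h a := by
    suffices H : (assocFun A B C q).comp (((A.tensor B).tensor C).act σ h) =
        ((A.tensor (B.tensor C)).act σ h).comp (assocFun A B C p) from LinearMap.congr_fun H a
    refine pure_ext₁ A B C fun z y a b c => ?_
    let y' : Set.Icc p.lo p.hi := ⟨y, y.2.1, y.2.2.trans z.2.2⟩
    let z' : Set.Icc (y : P) p.hi := ⟨z, y.2.2, z.2.2⟩
    have e1 := act_pure A B σ (Intv.move_left σ h z) y a b
    have e2 := act_pure (A.tensor B) C σ h z (pure A B (p.left z) y (a ⊗ₜ b)) c
    have e3 := act_pure B C σ (Intv.move_right σ h y') z' b c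
    have e4 := act_pure A (B.tensor C) σ h y' a (pure B C (p.right y') z' (b ⊗ₜ c))
    rw [e1] at e2
    rw [e3] at e4
    refine (congrArg (assocFun A B C q) e2).trans ((assocFun_pure A B C q _ _ _ _ _).trans ?_)
    exact ((congrArg ((A.tensor (B.tensor C)).act σ h) (assocFun_pure A B C p z y a b c)).trans
      e4).symm

theorem assocHom_bijective (p : Intv P) : Function.Bijective ((assocHom A B C).map p) := by
  refine Function.bijective_iff_has_inverse.2 ⟨assocInv A B C p, fun a => ?_, fun a => ?_⟩
  · suffices H : (assocInv A B C p).comp (assocFun A B C p) = LinearMap.id from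
      LinearMap.congr_fun H a
    refine pure_ext₁ A B C fun z y a b c => ?_
    let y' : Set.Icc p.lo p.hi := ⟨y, y.2.1, y.2.2.trans z.2.2⟩
    let z' : Set.Icc (y : P) p.hi := ⟨z, y.2.2, z.2.2⟩
    have e := assocInv_pure A B C p y' z' a b c
    exact (congrArg (assocInv A B C p) (assocFun_pure A B C p z y a b c)).trans e
  · suffices H : (assocFun A B C p).comp (assocInv A B C p) = LinearMap.id from
      LinearMap.congr_fun H a
    refine pure_ext₂ A B C fun y z a b c => ?_
    let z' : Set.Icc p.lo p.hi := ⟨z, y.2.1.trans z.2.1, z.2.2⟩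
    let y' : Set.Icc p.lo (z : P) := ⟨y, y.2.1, z.2.1⟩
    have e := assocFun_pure A B C p z' y' a b c
    exact (congrArg (assocFun A B C p) (assocInv_pure A B C p y z a b c)).trans e

open Classical in
def lunitFun (p : Intv P) : (unit.tensor A).V p →ₗ[k] A.V p :=
  desc fun y => TensorProduct.lift <|
    if h : p.lo = y then
      (LinearMap.lsmul k (A.V p)).compl₁₂ (LinearMap.proj ⟨⟨h⟩⟩)
        (A.act (1 : W) (by rw [one_smul]; ext <;> simp [h]))
    else 0

theorem lunitFun_pure_pos (p : Intv P) (y : Set.Icc p.lo p.hi) (c a) (h : p.lo = y)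
    (h' : (1 : W) • p.right y = p) :
    lunitFun A p (pure unit A p y (c ⊗ₜ a)) = c ⟨⟨h⟩⟩ • A.act (1 : W) h' a := by
  rw [lunitFun, desc_pure, dif_pos h]
  rfl

theorem lunitFun_pure_neg (p : Intv P) (y : Set.Icc p.lo p.hi) (c a) (h : ¬ p.lo = y) :
    lunitFun A p (pure unit A p y (c ⊗ₜ a)) = 0 := by
  rw [lunitFun, desc_pure, dif_neg h]
  rfl

/-- The left unit isomorphism. -/
def lunitHom : Hom (unit.tensor A) A where
  map p := lunitFun A p
  comm σ p q h a := by
    suffices H : (lunitFun A q).comp ((unit.tensor A).act σ h) =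
        (A.act σ h).comp (lunitFun A p) from LinearMap.congr_fun H a
    refine pure_ext fun y c a => ?_
    have e := act_pure unit A σ h y c a
    refine (congrArg (lunitFun A q) e).trans ?_
    rw [LinearMap.comp_apply]
    have hlo : q.lo = σ • p.lo := by rw [← h]; rfl
    by_cases hy : p.lo = y
    · have hp : (1 : W) • p.right y = p := by rw [one_smul]; ext <;> simp [hy]
      have hq : (1 : W) • q.right (Intv.move σ h y) = q := by
        rw [one_smul]; ext <;> simp [hlo, hy]
      rw [lunitFun_pure_pos A q _ _ _ (hlo.trans (congrArg (σ • ·) hy)) hq, lunitFun_pure_pos A p y c a hy hp,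
        map_smul, A.act_mul 1 σ _ _ (by rw [mul_smul, Intv.move_right σ h, hq]),
        A.act_mul σ 1 _ _ (by rw [mul_smul, hp, h])]
      congr 1
      exact act_congr A (by simp) _ _ _
    · rw [lunitFun_pure_neg A p y c a hy, lunitFun_pure_neg A q _ _ _
        (fun e => hy (MulAction.injective σ (hlo.symm.trans e))), map_zero]

theorem lunitHom_bijective (p : Intv P) : Function.Bijective ((lunitHom A).map p) := by
  let y₀ : Set.Icc p.lo p.hi := ⟨p.lo, le_rfl, p.le⟩
  have hp : (1 : W) • p.right y₀ = p := one_smul _ _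
  let inv : A.V p →ₗ[k] (unit.tensor A).V p :=
    pure unit A p y₀ ∘ₗ TensorProduct.mk k ((unit : EqFam.{max u v} k W (Intv P)).V (p.left y₀)) (A.V (p.right y₀)) (fun _ => 1)
  refine Function.bijective_iff_has_inverse.2 ⟨inv, fun a => ?_, fun a => ?_⟩
  · suffices H : inv.comp (lunitFun A p) = LinearMap.id from LinearMap.congr_fun H a
    refine pure_ext fun y c a => ?_
    rw [LinearMap.comp_apply, LinearMap.id_apply]
    by_cases hy : p.lo = y
    · obtain rfl : y₀ = y := Subtype.ext hy
      rw [lunitFun_pure_pos A p y₀ c a hy hp, map_smul]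
      have key : ∀ (c d : (unit : EqFam.{max u v} k W (Intv P)).V (p.left y₀)) (s : k),
          c = s • d → pure unit A p y₀ (c ⊗ₜ a) = s • pure unit A p y₀ (d ⊗ₜ a) := by
        rintro c d s rfl
        rw [← TensorProduct.smul_tmul', map_smul]
      have ha : A.act (1 : W) hp a = a := A.act_one _ _ a
      rw [ha]
      exact (key c (fun _ => 1) (c ⟨⟨hy⟩⟩) (funext fun z => (mul_one _).symm)).symm
    · rw [lunitFun_pure_neg A p y c a hy, map_zero]
      have hc : c = 0 := by funext z; exact absurd z.down.down hy
      rw [hc, TensorProduct.zero_tmul, map_zero]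
  · refine (lunitFun_pure_pos A p y₀ (fun _ => 1) a rfl hp).trans ?_
    rw [one_smul]
    exact A.act_one _ _ a

open Classical in
def runitFun (p : Intv P) : (A.tensor unit).V p →ₗ[k] A.V p :=
  desc fun y => TensorProduct.lift <|
    if h : (y : P) = p.hi then
      (LinearMap.lsmul k (A.V p)).flip.compl₁₂
        (A.act (1 : W) (by rw [one_smul]; ext <;> simp [h])) (LinearMap.proj ⟨⟨h⟩⟩)
    else 0

theorem runitFun_pure_pos (p : Intv P) (y : Set.Icc p.lo p.hi) (a c) (h : (y : P) = p.hi)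
    (h' : (1 : W) • p.left y = p) :
    runitFun A p (pure A unit p y (a ⊗ₜ c)) = c ⟨⟨h⟩⟩ • A.act (1 : W) h' a := by
  rw [runitFun, desc_pure, dif_pos h]
  rfl

theorem runitFun_pure_neg (p : Intv P) (y : Set.Icc p.lo p.hi) (a c) (h : ¬ (y : P) = p.hi) :
    runitFun A p (pure A unit p y (a ⊗ₜ c)) = 0 := by
  rw [runitFun, desc_pure, dif_neg h]
  rfl

/-- The right unit isomorphism. -/
def runitHom : Hom (A.tensor unit) A where
  map p := runitFun A p
  comm σ p q h a := by
    suffices H : (runitFun A q).comp ((A.tensor unit).act σ h) =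
        (A.act σ h).comp (runitFun A p) from LinearMap.congr_fun H a
    refine pure_ext fun y a c => ?_
    have e := act_pure A unit σ h y a c
    refine (congrArg (runitFun A q) e).trans ?_
    rw [LinearMap.comp_apply]
    have hhi : q.hi = σ • p.hi := by rw [← h]; rfl
    by_cases hy : (y : P) = p.hi
    · have hp : (1 : W) • p.left y = p := by rw [one_smul]; ext <;> simp [hy]
      have hq : (1 : W) • q.left (Intv.move σ h y) = q := by
        rw [one_smul]; ext <;> simp [hhi, hy]
      rw [runitFun_pure_pos A q _ _ _ ((congrArg (σ • ·) hy).trans hhi.symm) hq, runitFun_pure_pos A p y a c hy hp,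
        map_smul, A.act_mul 1 σ _ _ (by rw [mul_smul, Intv.move_left σ h, hq]),
        A.act_mul σ 1 _ _ (by rw [mul_smul, hp, h])]
      congr 1
      exact act_congr A (by simp) _ _ _
    · rw [runitFun_pure_neg A p y a c hy, runitFun_pure_neg A q _ _ _
        (fun e => hy (MulAction.injective σ (e.trans hhi))), map_zero]

theorem runitHom_bijective (p : Intv P) : Function.Bijective ((runitHom A).map p) := by
  let y₀ : Set.Icc p.lo p.hi := ⟨p.hi, p.le, le_rfl⟩
  have hp : (1 : W) • p.left y₀ = p := one_smul _ _
  let inv : A.V p →ₗ[k] (A.tensor unit).V p :=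
    pure A unit p y₀ ∘ₗ
      (TensorProduct.mk k (A.V (p.left y₀)) ((unit : EqFam.{max u v} k W (Intv P)).V (p.right y₀))).flip (fun _ => 1)
  refine Function.bijective_iff_has_inverse.2 ⟨inv, fun a => ?_, fun a => ?_⟩
  · suffices H : inv.comp (runitFun A p) = LinearMap.id from LinearMap.congr_fun H a
    refine pure_ext fun y a c => ?_
    rw [LinearMap.comp_apply, LinearMap.id_apply]
    by_cases hy : (y : P) = p.hi
    · obtain rfl : y₀ = y := Subtype.ext hy.symm
      rw [runitFun_pure_pos A p y₀ a c hy hp, map_smul]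
      have key : ∀ (c d : (unit : EqFam.{max u v} k W (Intv P)).V (p.right y₀)) (s : k),
          c = s • d → pure A unit p y₀ (a ⊗ₜ c) = s • pure A unit p y₀ (a ⊗ₜ d) := by
        rintro c d s rfl
        rw [TensorProduct.tmul_smul, map_smul]
      have ha : A.act (1 : W) hp a = a := A.act_one _ _ a
      rw [ha]
      exact (key c (fun _ => 1) (c ⟨⟨hy⟩⟩) (funext fun z => (mul_one _).symm)).symm
    · rw [runitFun_pure_neg A p y a c hy, map_zero]
      have hc : c = 0 := by funext z; exact absurd z.down.down hy
      rw [hc, TensorProduct.tmul_zero, map_zero]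
  · refine (runitFun_pure_pos A p y₀ a (fun _ => 1) rfl hp).trans ?_
    rw [one_smul]
    exact A.act_one _ _ a

end coherence

end EqFam

/-! ### The equivariant incidence algebra -/

variable (k W P) in
/-- The equivariant incidence algebra `I^W(P)`: the Grothendieck ring of the category of
equivariant families over the intervals of `P`. -/
abbrev IncAlg : Type (max (u + 1) (v + 1) w) :=
  K0.{max u v} k W (Intv P)

namespace IncAlg

open K0

variable [LocallyFiniteOrder P]

/-- Multiplication: `[U] [V] = [U ⊗ V]`. -/
def mulHom : IncAlg k W P →+ IncAlg k W P →+ IncAlg k W P :=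
  K0.lift (fun U => K0.lift (fun V => cls (U.tensor V))
      (fun _ _ _ i j h => cls_exact _ _ (EqFam.tensor_exact_left U i j h)))
    (fun A B C i j h => by
      ext z
      induction z using K0.induction with
      | zero => simp
      | cls V => simpa using cls_exact _ _ (EqFam.tensor_exact_right V i j h)
      | add a b ha hb => rw [map_add, ha, hb, map_add]
      | neg a ha => rw [map_neg, ha, map_neg])

theorem mulHom_cls (U V : EqFam.{max u v} k W (Intv P)) :
    mulHom (cls U) (cls V) = cls (U.tensor V) := by
  simp [mulHom]

theorem mulHom_assoc (a b c : IncAlg k W P) :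
    mulHom (mulHom a b) c = mulHom a (mulHom b c) := by
  induction a using K0.induction with
  | zero => simp
  | add a a' h h' => simp [h, h']
  | neg a h => simp [h]
  | cls A =>
  induction b using K0.induction with
  | zero => simp
  | add a a' h h' => simp [h, h']
  | neg a h => simp [h]
  | cls B =>
  induction c using K0.induction with
  | zero => simp
  | add a a' h h' => simp [h, h']
  | neg a h => simp [h]
  | cls C =>
  simp only [mulHom_cls]
  exact cls_eq_of_bijective (EqFam.assocHom A B C) (EqFam.assocHom_bijective A B C)

instance : Ring (IncAlg k W P) where
  __ := (inferInstance : AddCommGroup (IncAlg k W P))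
  mul a b := mulHom a b
  one := cls EqFam.unit
  left_distrib a b c := map_add (mulHom a) b c
  right_distrib a b c := by
    change mulHom (a + b) c = mulHom a c + mulHom b c
    rw [map_add, AddMonoidHom.add_apply]
  zero_mul a := by
    change mulHom 0 a = 0
    rw [map_zero, AddMonoidHom.zero_apply]
  mul_zero a := map_zero (mulHom a)
  mul_assoc := mulHom_assoc
  one_mul a := by
    change mulHom (cls EqFam.unit) a = a
    induction a using K0.induction with
    | zero => simp
    | add a a' h h' => simp [h, h']
    | neg a h => simp [h]
    | cls A =>
      rw [mulHom_cls]
      exact cls_eq_of_bijective (EqFam.lunitHom A) (EqFam.lunitHom_bijective A)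
  mul_one a := by
    change mulHom a (cls EqFam.unit) = a
    induction a using K0.induction with
    | zero => simp
    | add a a' h h' => simp [h, h']
    | neg a h => simp [h]
    | cls A =>
      rw [mulHom_cls]
      exact cls_eq_of_bijective (EqFam.runitHom A) (EqFam.runitHom_bijective A)

/-- The component `f_{xy} ∈ VRep(W_{xy})` of `f ∈ I^W(P)`, for an interval `p = [x, y]`. -/
def comp (p : Intv P) : IncAlg k W P →+ VRep.{max u v} k (p.stab W) :=
  K0.fiber p (p.stab W) (Intv.stab_smul p)

end IncAlg

variable [LocallyFiniteOrder P]

/-! ### Kazhdan-Lusztig-Stanley theory -/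

variable (W P) in
/-- A `W`-invariant weak rank function on `P`. -/
structure WeakRank where
  r : Intv P → ℕ
  pos : ∀ p : Intv P, p.lo < p.hi → 0 < r p
  add : ∀ {x y z : P} (hxy : x ≤ y) (hyz : y ≤ z),
    r ⟨x, y, hxy⟩ + r ⟨y, z, hyz⟩ = r ⟨x, z, hxy.trans hyz⟩
  inv : ∀ (σ : W) (p : Intv P), r (σ • p) = r p

/-- The coefficient of `t ^ n` in the component `f_{xy}(t)`, for an interval `p = [x, y]`.
Elements are written `f = ∑ f_n t ^ n` with `f_n ∈ I^W(P)`, inside `I^W(P)⟦t⟧`, because for an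
infinite poset the degrees of the polynomials `f_{xy}(t)` need not be bounded uniformly in `x ≤ y`;
in the sets `scriptI` and `scriptIHalf` below every component `f_{xy}(t)` is a polynomial. -/
def coeffAt (f : PowerSeries (IncAlg k W P)) (p : Intv P) (n : ℕ) : VRep.{max u v} k (p.stab W) :=
  IncAlg.comp p (PowerSeries.coeff n f)

/-- `f_{xx}(t) = δ_{xx}(t)` for all `x`; here `δ = 1`. -/
def DiagOne (f : PowerSeries (IncAlg k W P)) : Prop :=
  ∀ (x : P) (n : ℕ), coeffAt f ⟨x, x, le_rfl⟩ n = coeffAt 1 ⟨x, x, le_rfl⟩ n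

/-- `𝓘^W(P)`: the elements with `deg f_{xy}(t) ≤ r_{xy}` for all `x ≤ y`. -/
def scriptI (r : WeakRank W P) : Set (PowerSeries (IncAlg k W P)) :=
  {f | ∀ (p : Intv P) (n : ℕ), r.r p < n → coeffAt f p n = 0}

/-- `𝓘^W_{1/2}(P)`: the elements with `f_{xx}(t) = δ_{xx}(t)` for all `x` and
`deg f_{xy}(t) < r_{xy} / 2` for all `x < y`. -/
def scriptIHalf (r : WeakRank W P) : Set (PowerSeries (IncAlg k W P)) :=
  {f | DiagOne f ∧
    ∀ (p : Intv P) (n : ℕ), p.lo < p.hi → r.r p ≤ 2 * n → coeffAt f p n = 0}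

/-- `g` is the element `\bar f`, that is, `g_{xy}(t) = t ^ {r_{xy}} f_{xy}(t⁻¹)` for all
`x ≤ y` (for `f ∈ 𝓘^W(P)`). -/
def IsBar (r : WeakRank W P) (f g : PowerSeries (IncAlg k W P)) : Prop :=
  ∀ (p : Intv P) (n : ℕ), coeffAt g p n = if n ≤ r.r p then coeffAt f p (r.r p - n) else 0

/-- `κ ∈ 𝓘^W(P)` is a `P`-kernel: `κ_{xx}(t) = δ_{xx}(t)` for all `x`, and `\bar κ` is the
two-sided inverse of `κ`. -/
def IsPKernel (r : WeakRank W P) (κ : PowerSeries (IncAlg k W P)) : Prop :=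
  κ ∈ scriptI r ∧ DiagOne κ ∧ ∃ κ' : PowerSeries (IncAlg k W P), IsBar r κ κ' ∧ κ * κ' = 1 ∧ κ' * κ = 1

end

end

/-! Decompose by rank. An interval of rank `m` is cut by a point into intervals of ranks `i + j =
m`, so `I^W(P)⟦t⟧` behaves like a graded ring. Write `f_m` for the part of `f` on intervals of rank
`m`. Rank 0 is the diagonal, hence `κ_0 = f_0 = 1`, and for `m > 0` the equation `\bar f = κ f`
reads `\bar f_m - f_m = q_m`, where `q_m = ∑ κ_i f_j` over `i + j = m`, `j < m`, is already known.
Multiplying the truncated product `κ f` by `\bar κ = κ⁻¹` shows `\bar q_m = -q_m`. Such a `q_m` is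
`\bar h - h` for exactly one `h` of degree `< m / 2`, namely minus its lower half; for even `m` the
middle coefficient satisfies `c = -c` and has to vanish. The equation for `g` is the same one in the
opposite ring.

The work lies in justifying this inside a Grothendieck group. Three facts are needed.

Detection: an element of `I^W(P)` with all components zero is zero (`K0.eq_zero_of_fiber_eq_zero`).
There may be infinitely many orbits of intervals, so the relations that kill the components cannot
simply be added up. Heller's criterion (`EqFam.exists_isExt_of_cls_eq`) replaces them by two
extensions per orbit, with the same ends, and these can be assembled over all orbits at once.

Absence of 2-torsion (`VRep.eq_zero_of_add_self`): over any field, virtual representations are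
separated by integer-valued additive functions, the multiplicity of the eigenvalue 1 of elements of
the group algebra. Together with detection this removes the middle coefficient.

Assembly (`K0.exists_glue`): parts prescribed independently in each rank come from one element,
because the rank is constant on orbits. -/

noncomputable section

/-! ### Heller's criterion for equality in a Grothendieck group -/

namespace EqFam

universe t u w x

variable {k : Type u} {G : Type w} {X : Type x} [Field k] [Group G] [MulAction G X]

/-- The direct sum of two equivariant families. -/
def prod (A B : EqFam.{t} k G X) : EqFam.{t} k G X where
  V p := A.V p × B.V p
  act σ _ _ h := (A.act σ h).prodMap (B.act σ h)
  act_one p h a := Prod.ext (A.act_one p h a.1) (B.act_one p h a.2)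
  act_mul τ σ _ _ _ h h' h'' a := Prod.ext (A.act_mul τ σ h h' h'' a.1) (B.act_mul τ σ h h' h'' a.2)

/-- Two equivariant families are isomorphic. -/
def Iso (A B : EqFam.{t} k G X) : Prop :=
  ∃ e : ∀ p, A.V p ≃ₗ[k] B.V p, ∀ (σ : G) {p q : X} (h : σ • p = q) (a : A.V p),
    e q (A.act σ h a) = B.act σ h (e p a)

theorem Iso.refl (A : EqFam.{t} k G X) : Iso A A := ⟨fun _ => .refl k _, fun _ _ _ _ _ => rfl⟩

theorem Iso.symm {A B : EqFam.{t} k G X} : Iso A B → Iso B A := by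
  rintro ⟨e, he⟩
  refine ⟨fun p => (e p).symm, fun σ p q h b => ?_⟩
  rw [LinearEquiv.symm_apply_eq, he, LinearEquiv.apply_symm_apply]

theorem Iso.trans {A B C : EqFam.{t} k G X} : Iso A B → Iso B C → Iso A C := by
  rintro ⟨e, he⟩ ⟨f, hf⟩
  exact ⟨fun p => (e p).trans (f p), fun σ p q h a => by simp [he, hf]⟩

theorem Iso.prod {A B A' B' : EqFam.{t} k G X} :
    Iso A A' → Iso B B' → Iso (A.prod B) (A'.prod B') := by
  rintro ⟨e, he⟩ ⟨f, hf⟩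
  exact ⟨fun p => (e p).prodCongr (f p), fun σ p q h a => Prod.ext (he σ h a.1) (hf σ h a.2)⟩

theorem Iso.cls_eq {A B : EqFam.{t} k G X} : Iso A B → K0.cls A = K0.cls B := by
  rintro ⟨e, he⟩
  exact K0.cls_eq_of_bijective ⟨fun p => (e p).toLinearMap, he⟩ fun p => (e p).bijective

/-- `E` is an extension of `C` by `A`. -/
def IsExt (A E C : EqFam.{t} k G X) : Prop :=
  ∃ (i : Hom A E) (j : Hom E C), IsShortExact i j

theorem IsExt.cls_eq {A E C : EqFam.{t} k G X} (h : IsExt A E C) :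
    K0.cls E = K0.cls A + K0.cls C := by
  obtain ⟨i, j, h⟩ := h
  exact K0.cls_exact i j h

theorem isExt_prod (A C : EqFam.{t} k G X) : IsExt A (A.prod C) C :=
  ⟨⟨fun _ => LinearMap.inl k _ _, fun σ _ _ h _ => Prod.ext rfl (map_zero (C.act σ h)).symm⟩,
    ⟨fun _ => LinearMap.snd k _ _, fun _ _ _ _ _ => rfl⟩,
    fun _ => ⟨LinearMap.inl_injective, .inl_snd, LinearMap.snd_surjective⟩⟩

theorem IsExt.prod {A E C A' E' C' : EqFam.{t} k G X} :
    IsExt A E C → IsExt A' E' C' → IsExt (A.prod A') (E.prod E') (C.prod C') := by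
  rintro ⟨i, j, h⟩ ⟨i', j', h'⟩
  refine ⟨⟨fun p => (i.map p).prodMap (i'.map p), fun σ p q e a =>
      Prod.ext (i.comm σ e a.1) (i'.comm σ e a.2)⟩,
    ⟨fun p => (j.map p).prodMap (j'.map p), fun σ p q e a =>
      Prod.ext (j.comm σ e a.1) (j'.comm σ e a.2)⟩,
    fun p => ⟨(h p).1.prodMap (h' p).1, fun z => ?_, (h p).2.2.prodMap (h' p).2.2⟩⟩
  refine Prod.ext_iff.trans (((h p).2.1 z.1).and ((h' p).2.1 z.2) |>.trans ?_)
  exact ⟨fun ⟨⟨a, ha⟩, b, hb⟩ => ⟨(a, b), Prod.ext ha hb⟩,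
    fun ⟨a, ha⟩ => ⟨⟨a.1, congrArg Prod.fst ha⟩, a.2, congrArg Prod.snd ha⟩⟩

theorem IsExt.congr {A E C A' E' C' : EqFam.{t} k G X} (h : IsExt A E C) :
    Iso A A' → Iso E E' → Iso C C' → IsExt A' E' C' := by
  obtain ⟨i, j, h⟩ := h
  intro hA ⟨e, he⟩ ⟨c, hc⟩
  obtain ⟨a, ha⟩ := hA.symm
  refine ⟨⟨fun p => (e p).toLinearMap ∘ₗ i.map p ∘ₗ (a p).toLinearMap, fun σ p q h x => ?_⟩,
    ⟨fun p => (c p).toLinearMap ∘ₗ j.map p ∘ₗ (e p).symm.toLinearMap, fun σ p q h x => ?_⟩,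
    fun p => ⟨?_, fun z => ?_, ?_⟩⟩
  · simp [ha, i.comm, he]
  · obtain ⟨y, rfl⟩ := (e p).surjective x
    simp [← he, j.comm, hc]
  · exact (e p).injective.comp ((h p).1.comp (a p).injective)
  · obtain ⟨y, rfl⟩ := (e p).surjective z
    simp only [LinearMap.comp_apply, LinearEquiv.coe_coe, LinearEquiv.symm_apply_apply,
      LinearEquiv.map_eq_zero_iff, (h p).2.1 y]
    constructor
    · rintro ⟨x, rfl⟩
      exact ⟨(a p).symm x, by simp⟩
    · rintro ⟨x, hx⟩
      exact ⟨a p x, (e p).injective hx⟩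
  · exact (c p).surjective.comp ((h p).2.2.comp (e p).symm.surjective)

theorem cls_prod (A B : EqFam.{t} k G X) : K0.cls (A.prod B) = K0.cls A + K0.cls B :=
  (isExt_prod A B).cls_eq

variable (k G X) in
/-- Isomorphism as a setoid. -/
def isoSetoid : Setoid (EqFam.{t} k G X) := ⟨Iso, Iso.refl, Iso.symm, Iso.trans⟩

variable (k G X) in
/-- Isomorphism classes of equivariant families. -/
def IsoClass : Type _ := Quotient (isoSetoid.{t} k G X)

/-- The isomorphism class of an equivariant family. -/
def isoClass (A : EqFam.{t} k G X) : IsoClass.{t} k G X := Quotient.mk (isoSetoid k G X) A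

theorem isoClass_eq {A B : EqFam.{t} k G X} : isoClass A = isoClass B ↔ Iso A B :=
  Quotient.eq (r := isoSetoid k G X)

theorem isoClass_surjective : Function.Surjective (isoClass : EqFam.{t} k G X → _) :=
  Quotient.mk_surjective

instance : Add (IsoClass.{t} k G X) :=
  ⟨Quotient.map₂ prod fun _ _ h _ _ h' => h.prod h'⟩

theorem isoClass_prod (A B : EqFam.{t} k G X) :
    isoClass (A.prod B) = isoClass A + isoClass B := rfl

instance : Zero (IsoClass.{t} k G X) := ⟨isoClass zero⟩

instance : AddCommMonoid (IsoClass.{t} k G X) where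
  add_assoc a b c := by
    obtain ⟨A, rfl⟩ := isoClass_surjective a
    obtain ⟨B, rfl⟩ := isoClass_surjective b
    obtain ⟨C, rfl⟩ := isoClass_surjective c
    exact isoClass_eq.2 ⟨fun _ => LinearEquiv.prodAssoc k _ _ _, fun _ _ _ _ _ => rfl⟩
  add_comm a b := by
    obtain ⟨A, rfl⟩ := isoClass_surjective a
    obtain ⟨B, rfl⟩ := isoClass_surjective b
    exact isoClass_eq.2 ⟨fun _ => LinearEquiv.prodComm k _ _, fun _ _ _ _ _ => rfl⟩
  zero_add a := by
    obtain ⟨A, rfl⟩ := isoClass_surjective a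
    exact isoClass_eq.2 ⟨fun p => (LinearEquiv.uniqueProd : (PUnit.{t + 1} × A.V p) ≃ₗ[k] A.V p),
      fun _ _ _ _ _ => rfl⟩
  add_zero a := by
    obtain ⟨A, rfl⟩ := isoClass_surjective a
    exact isoClass_eq.2 ⟨fun p => (LinearEquiv.prodUnique : (A.V p × PUnit.{t + 1}) ≃ₗ[k] A.V p),
      fun _ _ _ _ _ => rfl⟩
  nsmul := nsmulRec

/-- Extensions on the level of isomorphism classes. -/
def IsExtClass (a e c : IsoClass.{t} k G X) : Prop :=
  ∃ A E C, isoClass A = a ∧ isoClass E = e ∧ isoClass C = c ∧ IsExt A E C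

theorem isExtClass_iff {A E C : EqFam.{t} k G X} :
    IsExtClass (isoClass A) (isoClass E) (isoClass C) ↔ IsExt A E C := by
  refine ⟨?_, fun h => ⟨_, _, _, rfl, rfl, rfl, h⟩⟩
  rintro ⟨A', E', C', hA, hE, hC, h⟩
  exact h.congr (isoClass_eq.1 hA) (isoClass_eq.1 hE) (isoClass_eq.1 hC)

theorem IsExtClass.add {a e c a' e' c' : IsoClass.{t} k G X} :
    IsExtClass a e c → IsExtClass a' e' c' → IsExtClass (a + a') (e + e') (c + c') := by
  rintro ⟨A, E, C, rfl, rfl, rfl, h⟩ ⟨A', E', C', rfl, rfl, rfl, h'⟩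
  exact ⟨_, _, _, rfl, rfl, rfl, h.prod h'⟩

theorem isExtClass_add (a c : IsoClass.{t} k G X) : IsExtClass a (a + c) c := by
  obtain ⟨A, rfl⟩ := isoClass_surjective a
  obtain ⟨C, rfl⟩ := isoClass_surjective c
  exact isExtClass_iff.2 (isExt_prod A C)

/-- Heller's relation: up to a common summand, `a` and `b` are extensions of the same objects. -/
def HellerRel (a b : IsoClass.{t} k G X) : Prop :=
  ∃ x y z, IsExtClass x (a + z) y ∧ IsExtClass x (b + z) y

theorem HellerRel.refl (a : IsoClass.{t} k G X) : HellerRel a a :=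
  ⟨a, 0, 0, isExtClass_add _ _, isExtClass_add _ _⟩

theorem HellerRel.symm {a b : IsoClass.{t} k G X} : HellerRel a b → HellerRel b a :=
  fun ⟨x, y, z, h, h'⟩ => ⟨x, y, z, h', h⟩

theorem HellerRel.add {a b a' b' : IsoClass.{t} k G X} :
    HellerRel a b → HellerRel a' b' → HellerRel (a + a') (b + b') := by
  rintro ⟨x, y, z, h₁, h₂⟩ ⟨x', y', z', h₁', h₂'⟩
  refine ⟨x + x', y + y', z + z', ?_, ?_⟩
  · rw [add_add_add_comm]; exact h₁.add h₁'
  · rw [add_add_add_comm]; exact h₂.add h₂'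

/-- The equation says that `a - b` and `a' - b'` agree in the group completion, so Heller's relation
depends only on the formal difference. This makes membership in `hellerSubgroup` usable for any
chosen representatives. -/
theorem HellerRel.of_add {a b a' b' c : IsoClass.{t} k G X} (h : HellerRel a' b')
    (e : a + b' + c = a' + b + c) : HellerRel a b := by
  obtain ⟨x, y, z, h₁, h₂⟩ := h
  -- Adding `b + c` to both the subobject and the middle term of the given extensions produces `a +
  -- (b' + c + z)` in one and `b + (b' + c + z)` in the other.
  refine ⟨x + (b + c), y, b' + c + z, ?_, ?_⟩
  · have := h₁.add (isExtClass_add (b + c) 0)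
    rw [add_zero, add_zero] at this
    convert this using 1
    calc a + (b' + c + z) = a + b' + c + z := by abel
      _ = _ := by rw [e]; abel
  · have := h₂.add (isExtClass_add (b + c) 0)
    rw [add_zero, add_zero] at this
    convert this using 1
    abel

variable (k G X) in
/-- The formal differences of pairs in Heller's relation. -/
def hellerSubgroup : AddSubgroup (Algebra.GrothendieckAddGroup (IsoClass.{t} k G X)) where
  carrier := {z | ∃ a b, HellerRel a b ∧
    z = Algebra.GrothendieckAddGroup.of a - Algebra.GrothendieckAddGroup.of b}
  zero_mem' := ⟨0, 0, .refl 0, by simp⟩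
  add_mem' := by
    rintro _ _ ⟨a, b, h, rfl⟩ ⟨a', b', h', rfl⟩
    refine ⟨_, _, h.add h', ?_⟩
    rw [map_add, map_add]
    abel
  neg_mem' := by
    rintro _ ⟨a, b, h, rfl⟩
    exact ⟨b, a, h.symm, neg_sub _ _⟩

theorem hellerRel_of_sub_mem {a b : IsoClass.{t} k G X}
    (h : Algebra.GrothendieckAddGroup.of a - Algebra.GrothendieckAddGroup.of b ∈
      hellerSubgroup k G X) : HellerRel a b := by
  obtain ⟨a', b', h', e⟩ := h
  rw [sub_eq_sub_iff_add_eq_add, ← map_add, ← map_add] at e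
  obtain ⟨c, hc⟩ := ((AddLocalization.addMonoidOf
    (⊤ : AddSubmonoid (IsoClass.{t} k G X))).eq_iff_exists).1 e
  refine h'.of_add (c := c) ?_
  rw [add_comm _ (c : IsoClass k G X), add_comm _ (c : IsoClass k G X)]
  exact hc

/-- Heller's criterion for equality in the Grothendieck group. -/
theorem exists_isExt_of_cls_eq {A B : EqFam.{t} k G X} (h : K0.cls A = K0.cls B) :
    ∃ X Y Z, IsExt X (A.prod Z) Y ∧ IsExt X (B.prod Z) Y := by
  let φ : K0.{t} k G X →+ Algebra.GrothendieckAddGroup (IsoClass.{t} k G X) ⧸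
      hellerSubgroup.{t} k G X :=
    K0.lift (fun A => QuotientAddGroup.mk' _ (Algebra.GrothendieckAddGroup.of (isoClass A)))
      fun A B C i j h => by
        rw [← map_add, ← map_add, ← isoClass_prod, QuotientAddGroup.mk'_eq_mk']
        -- The map respects the relation `[B] = [A] + [C]` because `B` and `A ⊕ C` are both
        -- extensions of `C` by `A`, hence in Heller's relation with `z = 0`.
        refine ⟨-(Algebra.GrothendieckAddGroup.of (isoClass B) -
          Algebra.GrothendieckAddGroup.of (isoClass (A.prod C))), neg_mem ⟨_, _,
          ⟨isoClass A, isoClass C, 0, ?_, ?_⟩, rfl⟩, by abel⟩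
        · rw [add_zero]
          exact isExtClass_iff.2 ⟨i, j, h⟩
        · rw [add_zero]
          exact isExtClass_iff.2 (isExt_prod A C)
  have hφ := congrArg φ h
  rw [K0.lift_cls, K0.lift_cls] at hφ
  have := hellerRel_of_sub_mem ((QuotientAddGroup.eq_iff_sub_mem).1 hφ)
  obtain ⟨x, y, z, h₁, h₂⟩ := this
  obtain ⟨X, rfl⟩ := isoClass_surjective x
  obtain ⟨Y, rfl⟩ := isoClass_surjective y
  obtain ⟨Z, rfl⟩ := isoClass_surjective z
  exact ⟨X, Y, Z, isExtClass_iff.1 h₁, isExtClass_iff.1 h₂⟩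

end EqFam

namespace K0

universe t u w x

variable {k : Type u} {G : Type w} {X : Type x} [Field k] [Group G] [MulAction G X]

theorem exists_eq_cls_sub_cls (z : K0.{t} k G X) : ∃ A B, z = cls A - cls B := by
  induction z using K0.induction with
  | zero => exact ⟨EqFam.zero, EqFam.zero, by simp⟩
  | cls A => exact ⟨A, EqFam.zero, by simp [cls_zero]⟩
  | add a b ha hb =>
    obtain ⟨A, B, rfl⟩ := ha
    obtain ⟨A', B', rfl⟩ := hb
    refine ⟨A.prod A', B.prod B', ?_⟩
    rw [EqFam.cls_prod, EqFam.cls_prod]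
    abel
  | neg a ha =>
    obtain ⟨A, B, rfl⟩ := ha
    exact ⟨B, A, neg_sub _ _⟩

end K0

/-! ### Virtual representations are separated by eigenvalue multiplicities -/

section charpoly

open Polynomial

variable {k A B C : Type*} [Field k] [AddCommGroup A] [AddCommGroup B] [AddCommGroup C]
  [Module k A] [Module k B] [Module k C] [FiniteDimensional k A] [FiniteDimensional k B]
  [FiniteDimensional k C]

/-- The characteristic polynomial is multiplicative in short exact sequences. -/
theorem LinearMap.charpoly_eq_mul_of_exact {i : A →ₗ[k] B} {j : B →ₗ[k] C}
    (hi : Function.Injective i) (hij : Function.Exact i j) (hj : Function.Surjective j)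
    {α : Module.End k A} {β : Module.End k B} {γ : Module.End k C}
    (hα : ∀ a, i (α a) = β (i a)) (hγ : ∀ b, j (β b) = γ (j b)) :
    β.charpoly = α.charpoly * γ.charpoly := by
  -- The splitting is only `k`-linear and need not commute with the endomorphisms. Its failure to do
  -- so fills the upper right block of `β`, which does not affect the characteristic polynomial.
  obtain ⟨s, hs⟩ := j.exists_rightInverse_of_surjective (LinearMap.range_eq_top.2 hj)
  have hs' : ∀ c, j (s c) = c := fun c => LinearMap.congr_fun hs c
  have hji : ∀ a, j (i a) = 0 := hij.apply_apply_eq_zero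
  let e : (A × C) ≃ₗ[k] B := LinearEquiv.ofBijective (i.coprod s) (by
    constructor
    · rw [injective_iff_map_eq_zero]
      rintro ⟨a, c⟩ h
      rw [LinearMap.coprod_apply] at h
      have hc := congrArg j h
      rw [map_add, hji, hs', zero_add, map_zero] at hc
      subst hc
      rw [map_zero, add_zero] at h
      exact Prod.ext (hi (h.trans (map_zero i).symm)) rfl
    · intro b
      obtain ⟨a, ha⟩ := (hij (b - s (j b))).1 (by rw [map_sub, hs', sub_self])
      exact ⟨(a, j b), by rw [LinearMap.coprod_apply, ha, sub_add_cancel]⟩)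
  have he : ∀ a c, e (a, c) = i a + s c := fun a c => LinearMap.coprod_apply _ _ _
  let φ : Module.End k (A × C) := e.symm.conj β
  have h₁ : ∀ a, φ (a, 0) = (α a, 0) := fun a => by
    change e.symm (β (e (a, 0))) = _
    rw [LinearEquiv.symm_apply_eq, he, he, map_zero, add_zero, add_zero, hα]
  have h₂ : ∀ x, (φ x).2 = γ x.2 := fun x => by
    have hje : ∀ y, j (e y) = y.2 := fun y => by rw [he, map_add, hji, hs', zero_add]
    rw [← hje, ← hje x, ← hγ]
    exact congrArg j (e.apply_symm_apply _)
  let b₁ := Module.finBasis k A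
  let b₂ := Module.finBasis k C
  rw [← LinearEquiv.charpoly_conj e.symm β, ← LinearMap.charpoly_toMatrix α b₁,
    ← LinearMap.charpoly_toMatrix γ b₂, ← LinearMap.charpoly_toMatrix _ (b₁.prod b₂)]
  let Φ := LinearMap.toMatrix (b₁.prod b₂) (b₁.prod b₂) φ
  have hΦ : Φ = Matrix.fromBlocks (LinearMap.toMatrix b₁ b₁ α) Φ.toBlocks₁₂ 0
      (LinearMap.toMatrix b₂ b₂ γ) := by
    ext (x | x) (y | y)
    · simp [Φ, LinearMap.toMatrix_apply, h₁]
    · rfl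
    · simp [Φ, LinearMap.toMatrix_apply, h₁]
    · simp [Φ, LinearMap.toMatrix_apply, h₂]
  change Φ.charpoly = _
  rw [hΦ, Matrix.charpoly_fromBlocks_zero₂₁]

end charpoly

section density

/-- Pairwise non-isomorphic finite dimensional simple modules over an algebra are separated by an
element of the algebra. -/
theorem exists_smul_eq_self_and_smul_eq_zero (k : Type*) {Λ ι : Type*} {M : ι → Type*} [Field k]
    [Ring Λ] [Algebra k Λ] [Finite ι] [∀ i, AddCommGroup (M i)] [∀ i, Module k (M i)]
    [∀ i, Module Λ (M i)] [∀ i, IsScalarTower k Λ (M i)] [∀ i, FiniteDimensional k (M i)]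
    [∀ i, IsSimpleModule Λ (M i)]
    (hM : ∀ i j, i ≠ j → IsEmpty (M i ≃ₗ[Λ] M j)) (o : ι) :
    ∃ a : Λ, (∀ m : M o, a • m = m) ∧ ∀ i, i ≠ o → ∀ m : M i, a • m = 0 := by
  classical
  have := Fintype.ofFinite ι
  -- By Schur's lemma every `Λ`-endomorphism of the product is diagonal.
  have schur : ∀ (g : Module.End Λ (∀ i, M i)) (i j : ι) (m : M i), i ≠ j →
      g (Pi.single i m) j = 0 := fun g i j m hij => by
    let f : M i →ₗ[Λ] M j := LinearMap.proj j ∘ₗ g ∘ₗ LinearMap.single Λ M i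
    rcases f.bijective_or_eq_zero with h | h
    · exact ((hM i j hij).false (LinearEquiv.ofBijective f h)).elim
    · exact LinearMap.congr_fun h m
  -- The projection to the factor `o` therefore commutes with all `Λ`-endomorphisms, and the density
  -- theorem realises it by some `a ∈ Λ` on any finite set; a finite `k`-spanning set suffices to
  -- get it everywhere.
  let f : Module.End (Module.End Λ (∀ i, M i)) (∀ i, M i) :=
    { toFun v := Pi.single o (v o)
      map_add' v w := by rw [Pi.add_apply, Pi.single_add]
      map_smul' g v := by
        simp only [Module.End.smul_def, RingHom.id_apply]
        ext j
        by_cases hj : j = o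
        · subst hj
          rw [Pi.single_eq_same]
          conv_lhs => rw [← Finset.univ_sum_single v, map_sum, Finset.sum_apply]
          exact Finset.sum_eq_single j (fun i _ hi => schur g i j _ hi) (by simp)
        · rw [Pi.single_eq_of_ne hj, schur g o j _ (Ne.symm hj)] }
  obtain ⟨s, hs⟩ := Module.Finite.fg_top (R := k) (M := ∀ i, M i)
  obtain ⟨a, ha⟩ := jacobson_density f s
  have key : ∀ v : ∀ i, M i, Pi.single o (v o) = a • v := fun v => by
    have hv : v ∈ Submodule.span k (s : Set (∀ i, M i)) := hs ▸ Submodule.mem_top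
    induction hv using Submodule.span_induction with
    | mem v hv => exact ha v hv
    | zero => simp
    | add v w _ _ hv hw => rw [Pi.add_apply, Pi.single_add, hv, hw, smul_add]
    | smul c v _ hv => rw [Pi.smul_apply, Pi.single_smul, hv, smul_algebra_smul_comm]
  refine ⟨a, fun m => ?_, fun i hi m => ?_⟩
  · have := congrFun (key (Pi.single o m)) o
    simpa using this.symm
  · have := congrFun (key (Pi.single i m)) i
    simpa [hi] using this.symm

end density

theorem Representation.map_asAlgebraHom {k G V V' : Type*} [Field k] [Group G] [AddCommGroup V]
    [Module k V] [AddCommGroup V'] [Module k V'] (ρ : Representation k G V)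
    (ρ' : Representation k G V') (f : V →ₗ[k] V') (hf : ∀ σ v, f (ρ σ v) = ρ' σ (f v))
    (a : MonoidAlgebra k G) (v : V) : f (ρ.asAlgebraHom a v) = ρ'.asAlgebraHom a (f v) := by
  induction a using MonoidAlgebra.induction_on with
  | of σ => rw [asAlgebraHom_of, asAlgebraHom_of, hf]
  | add a b ha hb => simp only [map_add, LinearMap.add_apply, ha, hb]
  | smul c a ha => simp only [map_smul, LinearMap.smul_apply, ha]

namespace EqFam

universe t u w x

section subobjects

variable {k : Type u} {G : Type w} {X : Type x} [Field k] [Group G] [MulAction G X]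

/-- The subfamily given by invariant subspaces. -/
def sub (A : EqFam.{t} k G X) (N : ∀ p, Submodule k (A.V p))
    (hN : ∀ (σ : G) {p q : X} (h : σ • p = q), N p ≤ (N q).comap (A.act σ h)) :
    EqFam.{t} k G X where
  V p := N p
  act σ _ _ h := (A.act σ h).restrict (hN σ h)
  act_one p h a := Subtype.ext (A.act_one p h a)
  act_mul τ σ _ _ _ h h' h'' a := Subtype.ext (A.act_mul τ σ h h' h'' a)

/-- The quotient family by invariant subspaces. -/
def quot (A : EqFam.{t} k G X) (N : ∀ p, Submodule k (A.V p))
    (hN : ∀ (σ : G) {p q : X} (h : σ • p = q), N p ≤ (N q).comap (A.act σ h)) :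
    EqFam.{t} k G X where
  V p := A.V p ⧸ N p
  act σ _ _ h := (N _).mapQ (N _) (A.act σ h) (hN σ h)
  act_one p h a := by
    obtain ⟨a, rfl⟩ := (N p).mkQ_surjective a
    exact congrArg (N p).mkQ (A.act_one p h a)
  act_mul τ σ p _ r h h' h'' a := by
    obtain ⟨a, rfl⟩ := (N p).mkQ_surjective a
    exact congrArg (N r).mkQ (A.act_mul τ σ h h' h'' a)

theorem isExt_sub_quot (A : EqFam.{t} k G X) (N : ∀ p, Submodule k (A.V p))
    (hN : ∀ (σ : G) {p q : X} (h : σ • p = q), N p ≤ (N q).comap (A.act σ h)) :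
    IsExt (A.sub N hN) A (A.quot N hN) :=
  ⟨⟨fun p => (N p).subtype, fun _ _ _ _ _ => rfl⟩, ⟨fun p => (N p).mkQ, fun _ _ _ _ _ => rfl⟩,
    fun p => ⟨(N p).injective_subtype, LinearMap.exact_subtype_mkQ (N p), (N p).mkQ_surjective⟩⟩

end subobjects

variable {k : Type u} {G : Type w} [Field k] [Group G]

/-- The representation on the only member of a family over a point. -/
def rho (A : EqFam.{t} k G PUnit.{1}) : Representation k G (A.V ⟨⟩) where
  toFun σ := A.act σ rfl
  map_one' := LinearMap.ext fun a => A.act_one _ _ a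
  map_mul' τ σ := LinearMap.ext fun a => (A.act_mul τ σ _ _ _ a).symm

theorem Hom.map_asAlgebraHom {A B : EqFam.{t} k G PUnit.{1}} (f : Hom A B) (a : MonoidAlgebra k G)
    (v : A.V ⟨⟩) : f.map ⟨⟩ (A.rho.asAlgebraHom a v) = B.rho.asAlgebraHom a (f.map ⟨⟩ v) :=
  Representation.map_asAlgebraHom A.rho B.rho (f.map ⟨⟩) (fun σ v => f.comm σ _ v) a v

theorem Iso.of_asModule {A B : EqFam.{t} k G PUnit.{1}}
    (e : A.rho.asModule ≃ₗ[MonoidAlgebra k G] B.rho.asModule) : Iso A B := by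
  refine ⟨fun _ => A.rho.asModuleEquiv.symm ≪≫ₗ e.restrictScalars k ≪≫ₗ B.rho.asModuleEquiv,
    fun σ p q h a => ?_⟩
  change B.rho.asModuleEquiv (e (A.rho.asModuleEquiv.symm (A.rho σ a))) =
    B.rho σ (B.rho.asModuleEquiv (e (A.rho.asModuleEquiv.symm a)))
  rw [Representation.asModuleEquiv_symm_map_rho, map_smul, ← LinearEquiv.eq_symm_apply,
    Representation.asModuleEquiv_symm_map_rho, LinearEquiv.symm_apply_apply]

/-- A family over a point is simple if it is an irreducible representation. -/
def IsSimple (A : EqFam.{t} k G PUnit.{1}) : Prop :=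
  IsSimpleModule (MonoidAlgebra k G) A.rho.asModule

/-- Induction on the dimension: a nonzero representation that is not simple has a proper nonzero
subrepresentation `N`, and `[A] = [N] + [A / N]`. -/
theorem cls_mem_closure_simple (A : EqFam.{t} k G PUnit.{1}) :
    K0.cls A ∈ AddSubgroup.closure {z : K0.{t} k G PUnit.{1} | ∃ S, IsSimple S ∧ z = K0.cls S} := by
  induction h : Module.finrank k (A.V ⟨⟩) using Nat.strong_induction_on generalizing A with
  | _ n ih =>
  subst h
  by_cases hs : IsSimple A
  · exact AddSubgroup.subset_closure ⟨A, hs, rfl⟩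
  rcases subsingleton_or_nontrivial (A.V ⟨⟩) with h0 | h0
  · have h : Iso A EqFam.zero := ⟨fun _ => (0 : A.V ⟨⟩ ≃ₗ[k] PUnit.{t + 1}), fun _ _ _ _ _ => rfl⟩
    rw [h.cls_eq, K0.cls_zero]
    exact zero_mem _
  obtain ⟨N, hb, ht⟩ : ∃ N : Submodule (MonoidAlgebra k G) A.rho.asModule, N ≠ ⊥ ∧ N ≠ ⊤ := by
    by_contra! H
    have : Nontrivial A.rho.asModule := h0
    exact hs ((isSimpleModule_iff _ _).2 ⟨fun N => or_iff_not_imp_left.2 (H N)⟩)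
  let N' : Submodule k (A.V ⟨⟩) := (N.restrictScalars k).comap A.rho.asModuleEquiv.symm.toLinearMap
  have hN' : ∀ (σ : G) {p q : PUnit.{1}} (h : σ • p = q), N' ≤ N'.comap (A.act σ h) :=
    fun σ p q h v hv => by
      change A.rho.asModuleEquiv.symm (A.rho σ v) ∈ N
      rw [Representation.asModuleEquiv_symm_map_rho]
      exact N.smul_mem _ hv
  have hN'b : N' ≠ ⊥ := fun h => hb (by
    refine (Submodule.eq_bot_iff _).2 fun x hx => ?_
    have : A.rho.asModuleEquiv x ∈ N' := by simpa [N'] using hx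
    rw [h, Submodule.mem_bot] at this
    simpa using this)
  have hN't : N' ≠ ⊤ := fun h => ht (by
    refine Submodule.eq_top_iff'.2 fun x => ?_
    have : A.rho.asModuleEquiv x ∈ N' := h ▸ Submodule.mem_top
    simpa [N'] using this)
  rw [(A.isExt_sub_quot (fun _ => N') hN').cls_eq]
  refine add_mem (ih _ ?_ (A.sub (fun _ => N') hN') rfl) (ih _ ?_ (A.quot (fun _ => N') hN') rfl)
  · exact Submodule.finrank_lt hN't
  · have h1 : 0 < Module.finrank k N' := by
      have := Submodule.nontrivial_iff_ne_bot.2 hN'b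
      exact Module.finrank_pos
    have h2 := N'.finrank_quotient_add_finrank
    change Module.finrank k (A.V ⟨⟩ ⧸ N') < _
    omega

/-- The multiplicity of the eigenvalue `1` of an element of the group algebra, as a function on
the Grothendieck group of representations. -/
def eigenMult (a : MonoidAlgebra k G) : K0.{t} k G PUnit.{1} →+ ℤ :=
  K0.lift (fun A => ((A.rho.asAlgebraHom a).charpoly.rootMultiplicity 1 : ℤ)) fun A B C i j h => by
    rw [LinearMap.charpoly_eq_mul_of_exact (h ⟨⟩).1 (h ⟨⟩).2.1 (h ⟨⟩).2.2
      (i.map_asAlgebraHom a) (j.map_asAlgebraHom a), Polynomial.rootMultiplicity_mul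
      (mul_ne_zero (LinearMap.charpoly_monic _).ne_zero (LinearMap.charpoly_monic _).ne_zero)]
    exact Nat.cast_add _ _

theorem eigenMult_cls (a : MonoidAlgebra k G) (A : EqFam.{t} k G PUnit.{1}) :
    eigenMult a (K0.cls A) = ((A.rho.asAlgebraHom a).charpoly.rootMultiplicity 1 : ℤ) :=
  K0.lift_cls _ _ _

theorem eigenMult_cls_of_smul_eq_zero {a : MonoidAlgebra k G} {A : EqFam.{t} k G PUnit.{1}}
    (h : ∀ v : A.rho.asModule, a • v = 0) : eigenMult a (K0.cls A) = 0 := by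
  have : A.rho.asAlgebraHom a = 0 := LinearMap.ext h
  rw [eigenMult_cls, this, LinearMap.charpoly_zero, Polynomial.rootMultiplicity_eq_zero, Nat.cast_zero]
  simp

theorem eigenMult_cls_of_smul_eq_self {a : MonoidAlgebra k G} {A : EqFam.{t} k G PUnit.{1}}
    (h : ∀ v : A.rho.asModule, a • v = v) :
    eigenMult a (K0.cls A) = Module.finrank k (A.V ⟨⟩) := by
  have : A.rho.asAlgebraHom a = 1 := LinearMap.ext h
  rw [eigenMult_cls, this, LinearMap.charpoly_one, ← Polynomial.C_1,
    Polynomial.rootMultiplicity_X_sub_C_pow]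

/-- Expand `z` in classes of simple representations. An `a` acting as the identity on one of them
and as zero on the others that occur gives `eigenMult a z` the value coefficient times dimension, so
the coefficient is zero. Root multiplicities are integers, whereas traces would only see
coefficients modulo the characteristic of `k`. -/
theorem eq_zero_of_eigenMult_eq_zero (z : K0.{t} k G PUnit.{1}) (h : ∀ a, eigenMult a z = 0) :
    z = 0 := by
  let 𝒮 : Set (K0.{t} k G PUnit.{1}) := {z | ∃ S, IsSimple S ∧ z = K0.cls S}
  have hz : z ∈ AddSubgroup.closure 𝒮 := by
    obtain ⟨A, B, rfl⟩ := z.exists_eq_cls_sub_cls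
    exact sub_mem (cls_mem_closure_simple A) (cls_mem_closure_simple B)
  rw [← Submodule.span_int_eq_addSubgroupClosure, Submodule.mem_toAddSubgroup,
    Finsupp.mem_span_iff_linearCombination] at hz
  obtain ⟨c, rfl⟩ := hz
  -- The index is the class and not the representation, so different indices have non-isomorphic
  -- `S`, as the separation argument requires.
  choose S hS hcls using fun s : 𝒮 => s.2
  suffices hc : c = 0 by rw [hc, map_zero]
  ext s
  by_contra hs
  have hs' : s ∈ c.support := Finsupp.mem_support_iff.2 hs
  have : ∀ i : c.support, IsSimpleModule (MonoidAlgebra k G) (S i).rho.asModule := fun i => hS i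
  obtain ⟨a, ha, ha'⟩ := exists_smul_eq_self_and_smul_eq_zero k
    (M := fun i : c.support => (S i).rho.asModule) (Λ := MonoidAlgebra k G)
    (fun i j hij => ⟨fun e => hij (Subtype.ext (Subtype.ext (by
      rw [hcls, hcls, (Iso.of_asModule e).cls_eq])))⟩) ⟨s, hs'⟩
  have key := h a
  rw [Finsupp.linearCombination_apply, Finsupp.sum, map_sum, Finset.sum_eq_single s] at key
  · rw [map_zsmul, hcls, eigenMult_cls_of_smul_eq_self ha, smul_eq_mul] at key
    have : IsSimpleModule (MonoidAlgebra k G) (S s).rho.asModule := hS s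
    have : Nontrivial (S s).rho.asModule := IsSimpleModule.nontrivial (MonoidAlgebra k G) _
    have : Nontrivial ((S s).V ⟨⟩) := this
    have hpos : 0 < Module.finrank k ((S s).V ⟨⟩) := Module.finrank_pos
    rcases mul_eq_zero.1 key with h | h
    · exact hs h
    · exact hpos.ne' (Int.natCast_eq_zero.1 h)
  · intro i hi his
    rw [map_zsmul, hcls,
      eigenMult_cls_of_smul_eq_zero (ha' ⟨i, hi⟩ fun e => his (congrArg Subtype.val e)), smul_zero]
  · exact fun h => absurd hs' h

end EqFam

/-- The group of virtual representations has no `2`-torsion. -/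
theorem VRep.eq_zero_of_add_self {k : Type*} {G : Type*} [Field k] [Group G] {z : VRep k G}
    (h : z + z = 0) : z = 0 := by
  refine EqFam.eq_zero_of_eigenMult_eq_zero z fun a => ?_
  have := congrArg (EqFam.eigenMult a) h
  rw [map_add, map_zero] at this
  omega

/-! ### Equivariant families are determined by their members at orbit representatives -/

namespace EqFam

universe t u w x

variable {k : Type u} {G : Type w} {X : Type x} [Field k] [Group G] [MulAction G X]

theorem act_act (A : EqFam.{t} k G X) {τ σ ρ : G} (hρ : ρ = τ * σ) {p q r : X} (h : σ • p = q)
    (h' : τ • q = r) (h'' : ρ • p = r) (a : A.V p) :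
    A.act τ h' (A.act σ h a) = A.act ρ h'' a := by
  subst hρ
  exact A.act_mul τ σ h h' h'' a

section transport

variable {H : X → Subgroup G} (hH : ∀ p σ, σ ∈ H p ↔ σ • p = p)

/-- The action of `σ` on the representation `F p`, where `σ • p = p' = p`. -/
def transport (F : ∀ p, EqFam.{t} k (H p) PUnit.{1}) {p p' : X} (e : p = p') (σ : G)
    (h : σ • p = p') : (F p).V ⟨⟩ →ₗ[k] (F p').V ⟨⟩ := by
  subst e
  exact (F p).act ⟨σ, (hH p σ).2 h⟩ rfl

theorem transport_one (F : ∀ p, EqFam.{t} k (H p) PUnit.{1}) {p : X} (e : p = p) (σ : G)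
    (h : σ • p = p) (hσ : σ = 1) (a) : transport hH F e σ h a = a := by
  subst hσ
  exact (F p).act_one _ _ a

theorem transport_mul (F : ∀ p, EqFam.{t} k (H p) PUnit.{1}) {p q r : X} (e : p = q) (e' : q = r)
    (e'' : p = r) (τ σ ρ : G) (h : σ • p = q) (h' : τ • q = r) (h'' : ρ • p = r) (hρ : ρ = τ * σ)
    (a) : transport hH F e' τ h' (transport hH F e σ h a) = transport hH F e'' ρ h'' a := by
  subst e e' hρ
  exact (F p).act_mul _ _ _ _ _ a

theorem transport_comm {F F' : ∀ p, EqFam.{t} k (H p) PUnit.{1}} (f : ∀ p, Hom (F p) (F' p))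
    {p q : X} (e : p = q) (σ : G) (h : σ • p = q) (a) :
    (f q).map ⟨⟩ (transport hH F e σ h a) = transport hH F' e σ h ((f p).map ⟨⟩ a) := by
  subst e
  exact (f p).comm _ _ a

theorem transport_fiber (A : EqFam.{t} k G X) {p q : X} (e : p = q) (σ : G)
    (h : σ • p = q) (a) :
    transport hH (fun p => A.fiber p (H p) fun σ => (hH p σ).1) e σ h a = A.act σ h a := by
  subst e
  rfl

variable {ρ : X → X} (hρ : ∀ (σ : G) p, ρ (σ • p) = ρ p) (s : X → G) (hs : ∀ p, s p • ρ p = p)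

include hρ in
theorem rep_eq {p q : X} (σ : G) (h : σ • p = q) : ρ p = ρ q := by rw [← h, hρ]

include hs in
theorem conj_smul_rep {p q : X} (σ : G) (h : σ • p = q) :
    ((s q)⁻¹ * σ * s p) • ρ p = ρ q := by
  rw [mul_smul, mul_smul, hs, h, inv_smul_eq_iff, hs]

/-- The family with given representations at the representatives `ρ p` of the orbits. -/
def ofOrbits (F : ∀ p, EqFam.{t} k (H p) PUnit.{1}) : EqFam.{t} k G X where
  V p := (F (ρ p)).V ⟨⟩
  -- The chosen elements `s` turn `σ : p → q` into an element of the stabilizer of the common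
  -- representative `ρ p = ρ q`. This equality is not definitional, which is why `transport` allows
  -- two indices.
  act σ p q h := transport hH F (rep_eq hρ σ h) ((s q)⁻¹ * σ * s p) (conj_smul_rep s hs σ h)
  act_one p h a := transport_one hH F _ _ _ (by group) a
  act_mul τ σ p q r h h' h'' a := transport_mul hH F _ _ _ _ _ _ _ _ _ (by group) a

theorem IsExt.ofOrbits {A E C : ∀ p, EqFam.{t} k (H p) PUnit.{1}}
    (h : ∀ p, IsExt (A p) (E p) (C p)) :
    IsExt (ofOrbits hH hρ s hs A) (ofOrbits hH hρ s hs E) (ofOrbits hH hρ s hs C) := by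
  choose i j h using h
  exact ⟨⟨fun p => (i (ρ p)).map ⟨⟩, fun σ p q _ a => transport_comm hH i _ _ _ a⟩,
    ⟨fun p => (j (ρ p)).map ⟨⟩, fun σ p q _ a => transport_comm hH j _ _ _ a⟩,
    fun p => h (ρ p) ⟨⟩⟩

theorem iso_ofOrbits (A : EqFam.{t} k G X) :
    Iso (ofOrbits hH hρ s hs fun p => A.fiber p (H p) fun σ => (hH p σ).1) A := by
  have hs' : ∀ p, (s p)⁻¹ • p = ρ p := fun p => by rw [inv_smul_eq_iff, hs]
  refine ⟨fun p => LinearEquiv.ofBijective (A.act (s p) (hs p))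
    (Function.bijective_iff_has_inverse.2 ⟨A.act (s p)⁻¹ (hs' p), fun a => ?_, fun a => ?_⟩),
    fun σ p q h a => ?_⟩
  · rw [A.act_act (ρ := 1) (by group) _ _ (one_smul _ _), A.act_one]
  · rw [A.act_act (ρ := 1) (by group) _ _ (one_smul _ _), A.act_one]
  · have h' : (σ * s p) • ρ p = q := by rw [mul_smul, hs, h]
    have e := transport_fiber hH A (rep_eq hρ σ h) _ (conj_smul_rep s hs σ h) a
    refine (congrArg (A.act (s q) (hs q)) e).trans ?_
    exact (A.act_act (by group) _ (hs q) h' a).trans (A.act_act rfl _ h h' a).symm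

end transport

end EqFam

/-- An element of the Grothendieck group of equivariant families is determined by its members, as
virtual representations of the stabilizers. -/
theorem K0.eq_zero_of_fiber_eq_zero {k : Type*} {G : Type*} {X : Type*} [Field k] [Group G]
    [MulAction G X] {H : X → Subgroup G} (hH : ∀ p σ, σ ∈ H p ↔ σ • p = p) {z : K0 k G X}
    (hz : ∀ p, K0.fiber p (H p) (fun σ => (hH p σ).1) z = 0) : z = 0 := by
  let ρ : X → X := fun p => (Quotient.mk (MulAction.orbitRel G X) p).out
  have hρ : ∀ (σ : G) p, ρ (σ • p) = ρ p := fun σ p =>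
    congrArg Quotient.out (Quotient.sound (s := MulAction.orbitRel G X) ⟨σ, rfl⟩)
  have : ∀ p, ∃ σ : G, σ • ρ p = p := fun p =>
    (MulAction.orbitRel G X).symm (Quotient.mk_out (s := MulAction.orbitRel G X) p)
  choose s hs using this
  obtain ⟨A, B, rfl⟩ := z.exists_eq_cls_sub_cls
  have hAB : ∀ p, K0.cls (A.fiber p (H p) fun σ => (hH p σ).1) =
      K0.cls (B.fiber p (H p) fun σ => (hH p σ).1) := fun p => by
    have := hz p
    rw [map_sub, sub_eq_zero, K0.fiber, K0.lift_cls, K0.lift_cls] at this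
    exact this
  -- For each `p` two extensions with the same ends `E p`, `C p` express the equality of classes.
  -- Being of this uniform shape, they can be glued over any number of orbits.
  choose E C Z h₁ h₂ using fun p => EqFam.exists_isExt_of_cls_eq (hAB p)
  -- The right-hand side does not involve `D`, so using `key` for `A` and for `B` and cancelling the
  -- class built from `Z` gives `[A] = [B]`.
  have key : ∀ D : EqFam k G X,
      (∀ p, EqFam.IsExt (E p) ((D.fiber p (H p) fun σ => (hH p σ).1).prod (Z p)) (C p)) →
      K0.cls D + K0.cls (EqFam.ofOrbits hH hρ s hs Z) =
        K0.cls (EqFam.ofOrbits hH hρ s hs E) + K0.cls (EqFam.ofOrbits hH hρ s hs C) := by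
    intro D hD
    rw [← (EqFam.IsExt.ofOrbits hH hρ s hs hD).cls_eq, (EqFam.IsExt.ofOrbits hH hρ s hs
      fun p => EqFam.isExt_prod (D.fiber p (H p) fun σ => (hH p σ).1) (Z p)).cls_eq,
      (EqFam.iso_ofOrbits hH hρ s hs D).cls_eq]
  rw [sub_eq_zero]
  exact add_right_cancel ((key A h₁).trans (key B h₂).symm)

/-! ### Restriction to invariant sets, and gluing along an invariant function -/

namespace EqFam

universe t u w x

variable {k : Type u} {G : Type w} {X : Type x} [Field k] [Group G] [MulAction G X]

section cut

variable (S : Set X) (hS : ∀ (σ : G) p, σ • p ∈ S ↔ p ∈ S)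

/-- The subfamily of `A` supported on an invariant set `S`. -/
def cut (A : EqFam.{t} k G X) : EqFam.{t} k G X :=
  A.sub (fun p => { carrier := {a | p ∉ S → a = 0}
                    add_mem' := fun ha hb h => by rw [ha h, hb h, add_zero]
                    zero_mem' := fun _ => rfl
                    smul_mem' := fun c a ha h => by rw [ha h, smul_zero] })
    fun σ p q h a ha hq => by
      rw [ha (by rwa [← hS σ, h]), map_zero]

theorem mem_cut {A : EqFam.{t} k G X} {p : X} (a : (A.cut S hS).V p) (hp : p ∉ S) : a = 0 :=
  Subtype.ext (a.2 hp)

/-- Restriction of a morphism to the subfamilies supported on `S`. -/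
def Hom.cut {A B : EqFam.{t} k G X} (f : Hom A B) : Hom (A.cut S hS) (B.cut S hS) where
  map p := (f.map p).restrict fun a ha hp => by rw [ha hp, map_zero]
  comm σ _ _ h a := Subtype.ext (f.comm σ h a.1)

theorem IsShortExact.cut {A B C : EqFam.{t} k G X} {i : Hom A B} {j : Hom B C}
    (h : IsShortExact i j) : IsShortExact (i.cut S hS) (j.cut S hS) := by
  refine fun p => ⟨fun a b e => Subtype.ext ((h p).1 (congrArg Subtype.val e)), fun b => ?_,
    fun c => ?_⟩
  · constructor
    · intro hb
      obtain ⟨a, ha⟩ := ((h p).2.1 b.1).1 (congrArg Subtype.val hb)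
      exact ⟨⟨a, fun hp => (h p).1 (by rw [ha, b.2 hp, map_zero])⟩, Subtype.ext ha⟩
    · rintro ⟨a, rfl⟩
      exact Subtype.ext ((h p).2.1.apply_apply_eq_zero a.1)
  · by_cases hp : p ∈ S
    · obtain ⟨b, hb⟩ := (h p).2.2 c.1
      exact ⟨⟨b, fun hp' => (hp' hp).elim⟩, Subtype.ext hb⟩
    · exact ⟨0, by rw [map_zero, mem_cut S hS c hp]⟩

theorem iso_cut_prod_cut_compl (A : EqFam.{t} k G X) :
    Iso ((A.cut S hS).prod (A.cut Sᶜ fun σ p => (hS σ p).not)) A := by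
  refine ⟨fun p => LinearEquiv.ofBijective
    ((Submodule.subtype _).coprod (Submodule.subtype _)) ⟨?_, fun a => ?_⟩, fun σ p q h a => ?_⟩
  · rw [injective_iff_map_eq_zero]
    rintro ⟨a, b⟩ h
    change a.1 + b.1 = 0 at h
    by_cases hp : p ∈ S
    · have hb : b.1 = 0 := b.2 fun h => h hp
      rw [hb, add_zero] at h
      exact Prod.ext (Subtype.ext h) (Subtype.ext hb)
    · have ha : a.1 = 0 := a.2 hp
      rw [ha, zero_add] at h
      exact Prod.ext (Subtype.ext ha) (Subtype.ext h)
  · by_cases hp : p ∈ S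
    · exact ⟨(⟨a, fun h => (h hp).elim⟩, 0), add_zero a⟩
    · exact ⟨(0, ⟨a, fun h => (h hp).elim⟩), zero_add a⟩
  · exact (map_add (A.act σ h) a.1.1 a.2.1).symm

end cut

section glue

variable {ι : Type*} (r : X → ι) (hr : ∀ (σ : G) p, r (σ • p) = r p)

/-- The action of `σ`, for a family of equivariant families with equal indices. -/
def actIdx (F : ι → EqFam.{t} k G X) {m n : ι} (e : m = n) (σ : G) {p q : X} (h : σ • p = q) :
    (F m).V p →ₗ[k] (F n).V q := by
  subst e
  exact (F m).act σ h

include hr in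
theorem idx_eq {p q : X} (σ : G) (h : σ • p = q) : r p = r q := by rw [← h, hr]

/-- The family whose member at `p` is that of `F (r p)`. -/
def glue (F : ι → EqFam.{t} k G X) : EqFam.{t} k G X where
  V p := (F (r p)).V p
  act σ p q h := actIdx F (idx_eq r hr σ h) σ h
  act_one p h a := (F (r p)).act_one p h a
  act_mul τ σ p q s h h' h'' a := by
    have : ∀ {l m n : ι} (e : l = m) (e' : m = n) (e'' : l = n) (a : (F l).V p),
        actIdx F e' τ h' (actIdx F e σ h a) = actIdx F e'' (τ * σ) h'' a := by
      rintro l _ _ rfl rfl _ a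
      exact (F l).act_mul τ σ h h' h'' a
    exact this _ _ _ a

theorem iso_fiber_glue (F : ι → EqFam.{t} k G X) (p : X) (H : Subgroup G)
    (hH : ∀ σ ∈ H, σ • p = p) : Iso ((glue r hr F).fiber p H hH) ((F (r p)).fiber p H hH) :=
  ⟨fun _ => LinearEquiv.refl k _, fun _ _ _ _ _ => rfl⟩

end glue

end EqFam

namespace K0

universe t u w x

variable {k : Type u} {G : Type w} {X : Type x} [Field k] [Group G] [MulAction G X]

/-- Restriction to an invariant set. -/
def cut (S : Set X) (hS : ∀ (σ : G) p, σ • p ∈ S ↔ p ∈ S) : K0.{t} k G X →+ K0.{t} k G X :=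
  lift (fun A => cls (A.cut S hS)) fun _ _ _ _ _ h => cls_exact _ _ (h.cut S hS)

theorem cut_cls (S : Set X) (hS : ∀ (σ : G) p, σ • p ∈ S ↔ p ∈ S) (A : EqFam.{t} k G X) :
    cut S hS (cls A) = cls (A.cut S hS) := lift_cls _ _ _

theorem cut_add_cut_compl (S : Set X) (hS : ∀ (σ : G) p, σ • p ∈ S ↔ p ∈ S) (z : K0.{t} k G X) :
    cut S hS z + cut Sᶜ (fun σ p => (hS σ p).not) z = z := by
  induction z using K0.induction with
  | zero => simp
  | cls A => rw [cut_cls, cut_cls, ← EqFam.cls_prod, (EqFam.iso_cut_prod_cut_compl S hS A).cls_eq]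
  | add a b ha hb => rw [map_add, map_add, add_add_add_comm, ha, hb]
  | neg a ha => rw [map_neg, map_neg, ← neg_add, ha]

theorem fiber_cls (p : X) (H : Subgroup G) (hH : ∀ σ ∈ H, σ • p = p) (A : EqFam.{t} k G X) :
    fiber p H hH (cls A) = cls (A.fiber p H hH) := lift_cls _ _ _

theorem fiber_cls_eq_zero (p : X) (H : Subgroup G) (hH : ∀ σ ∈ H, σ • p = p)
    {A : EqFam.{t} k G X} (hA : Subsingleton (A.V p)) : fiber p H hH (cls A) = 0 := by
  have h : EqFam.Iso (A.fiber p H hH) EqFam.zero :=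
    ⟨fun _ => (0 : A.V p ≃ₗ[k] PUnit.{t + 1}), fun _ _ _ _ _ => rfl⟩
  rw [fiber_cls, h.cls_eq, cls_zero]

theorem fiber_cut_of_notMem {S : Set X} (hS : ∀ (σ : G) p, σ • p ∈ S ↔ p ∈ S) {p : X}
    (H : Subgroup G) (hH : ∀ σ ∈ H, σ • p = p) (hp : p ∉ S) (z : K0.{t} k G X) :
    fiber p H hH (cut S hS z) = 0 := by
  induction z using K0.induction with
  | zero => simp
  | cls A =>
    rw [cut_cls]
    exact fiber_cls_eq_zero p H hH ⟨fun a b => by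
      rw [EqFam.mem_cut S hS a hp, EqFam.mem_cut S hS b hp]⟩
  | add a b ha hb => rw [map_add, map_add, ha, hb, add_zero]
  | neg a ha => rw [map_neg, map_neg, ha, neg_zero]

theorem fiber_cut_of_mem {S : Set X} (hS : ∀ (σ : G) p, σ • p ∈ S ↔ p ∈ S) {p : X}
    (H : Subgroup G) (hH : ∀ σ ∈ H, σ • p = p) (hp : p ∈ S) (z : K0.{t} k G X) :
    fiber p H hH (cut S hS z) = fiber p H hH z := by
  conv_rhs => rw [← cut_add_cut_compl S hS z, map_add,
    fiber_cut_of_notMem (S := Sᶜ) (fun σ p => (hS σ p).not) H hH (fun h => h hp), add_zero]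

/-- Each `z i` is a difference of two actual families, and families can be glued because on one
orbit only a single index occurs. -/
theorem exists_glue {ι : Type*} (r : X → ι) (hr : ∀ (σ : G) p, r (σ • p) = r p)
    (z : ι → K0.{t} k G X) : ∃ y : K0.{t} k G X, ∀ (p : X) (H : Subgroup G)
      (hH : ∀ σ ∈ H, σ • p = p), fiber p H hH y = fiber p H hH (z (r p)) := by
  choose A B h using fun i => (z i).exists_eq_cls_sub_cls
  refine ⟨cls (EqFam.glue r hr A) - cls (EqFam.glue r hr B), fun p H hH => ?_⟩
  rw [h, map_sub, map_sub, fiber_cls, fiber_cls, fiber_cls, fiber_cls,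
    (EqFam.iso_fiber_glue r hr A p H hH).cls_eq, (EqFam.iso_fiber_glue r hr B p H hH).cls_eq]

end K0

/-! ### The grading of the incidence algebra by rank -/

namespace IncAlg

universe u v w

variable {k : Type u} {W : Type w} {P : Type v} [Field k] [Group W] [PartialOrder P]
  [PosetAction W P]

theorem mem_stab_iff (p : Intv P) (σ : W) : σ ∈ p.stab W ↔ σ • p = p := by
  rw [Intv.ext_iff]
  rfl

variable [LocallyFiniteOrder P]

theorem eq_zero_of_comp_eq_zero {a : IncAlg k W P} (h : ∀ p, comp p a = 0) : a = 0 :=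
  have h' : ∀ p, K0.fiber p (p.stab W) (fun σ => (mem_stab_iff p σ).1) a = 0 := h
  K0.eq_zero_of_fiber_eq_zero (H := fun p : Intv P => p.stab W) mem_stab_iff h'

theorem ext_comp {a b : IncAlg k W P} (h : ∀ p, comp p a = comp p b) : a = b :=
  sub_eq_zero.1 (eq_zero_of_comp_eq_zero fun p => by rw [map_sub, h, sub_self])

theorem eq_zero_of_add_self {a : IncAlg k W P} (h : a + a = 0) : a = 0 :=
  eq_zero_of_comp_eq_zero fun p => VRep.eq_zero_of_add_self (by rw [← map_add, h, map_zero])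

theorem cls_mul_cls (A B : EqFam.{max u v} k W (Intv P)) :
    (K0.cls A * K0.cls B : IncAlg k W P) = K0.cls (A.tensor B) := mulHom_cls A B

theorem comp_cls_mul_cls_eq_zero {A B : EqFam.{max u v} k W (Intv P)} {p : Intv P}
    (h : ∀ y : Set.Icc p.lo p.hi, Subsingleton (A.V (p.left y)) ∨ Subsingleton (B.V (p.right y))) :
    comp p (K0.cls A * K0.cls B) = 0 := by
  rw [cls_mul_cls]
  have : ∀ y : Set.Icc p.lo p.hi, Subsingleton (A.V (p.left y) ⊗[k] B.V (p.right y)) := fun y =>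
    ⟨fun a b => by
      have key : ∀ c : A.V (p.left y) ⊗[k] B.V (p.right y), c = 0 := fun c => by
        induction c using TensorProduct.induction_on with
        | zero => rfl
        | add c d hc hd => rw [hc, hd, add_zero]
        | tmul a b =>
          rcases h y with h | h
          · rw [Subsingleton.elim a 0, TensorProduct.zero_tmul]
          · rw [Subsingleton.elim b 0, TensorProduct.tmul_zero]
      rw [key a, key b]⟩
  exact K0.fiber_cls_eq_zero p _ _ (inferInstanceAs
    (Subsingleton (⨁ y : Set.Icc p.lo p.hi, A.V (p.left y) ⊗[k] B.V (p.right y))))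

variable (r : WeakRank W P)

omit [LocallyFiniteOrder P] in
theorem smul_mem_rank_iff (N : Set ℕ) (σ : W) (p : Intv P) :
    σ • p ∈ {p | r.r p ∈ N} ↔ p ∈ {p | r.r p ∈ N} := by
  rw [Set.mem_ofPred_eq, r.inv]
  rfl

/-- The part of an element supported on the intervals with rank in `N`. -/
def rankCut (N : Set ℕ) : IncAlg k W P →+ IncAlg k W P :=
  K0.cut {p | r.r p ∈ N} (smul_mem_rank_iff r N)

theorem rankCut_cls (N : Set ℕ) (A : EqFam.{max u v} k W (Intv P)) :
    rankCut r N (K0.cls A) = K0.cls (A.cut {p | r.r p ∈ N} (smul_mem_rank_iff r N)) :=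
  K0.cut_cls {p | r.r p ∈ N} (smul_mem_rank_iff r N) A

theorem comp_rankCut_of_mem {N : Set ℕ} {p : Intv P} (h : r.r p ∈ N) (a : IncAlg k W P) :
    comp p (rankCut r N a) = comp p a :=
  K0.fiber_cut_of_mem (S := {p | r.r p ∈ N}) (smul_mem_rank_iff r N) (p.stab W)
    (Intv.stab_smul p) h a

theorem comp_rankCut_of_notMem {N : Set ℕ} {p : Intv P} (h : r.r p ∉ N) (a : IncAlg k W P) :
    comp p (rankCut r N a) = 0 :=
  K0.fiber_cut_of_notMem (S := {p | r.r p ∈ N}) (smul_mem_rank_iff r N) (p.stab W)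
    (Intv.stab_smul p) h a

theorem exists_eq_cls_sub_cls (a : IncAlg k W P) :
    ∃ A B : EqFam.{max u v} k W (Intv P), a = (K0.cls A : IncAlg k W P) - K0.cls B :=
  K0.exists_eq_cls_sub_cls a

/-- The ranks of the two pieces of `p` at a point `y` add up to the rank of `p`, so in each summand
of the tensor product one factor is zero. -/
theorem comp_rankCut_mul_rankCut_eq_zero {M N : Set ℕ} {p : Intv P}
    (h : ∀ m ∈ M, ∀ n ∈ N, m + n ≠ r.r p) (a b : IncAlg k W P) :
    comp p (rankCut r M a * rankCut r N b) = 0 := by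
  have key : ∀ A B : EqFam.{max u v} k W (Intv P),
      comp p (rankCut r M (K0.cls A) * rankCut r N (K0.cls B)) = 0 := fun A B => by
    rw [rankCut_cls, rankCut_cls]
    refine comp_cls_mul_cls_eq_zero fun y => ?_
    by_cases hy : r.r (p.left y) ∈ M
    · have hy' : r.r (p.right y) ∉ N := fun hy' => h _ hy _ hy' (r.add y.2.1 y.2.2)
      exact .inr ⟨fun a b => (EqFam.mem_cut _ _ a hy').trans (EqFam.mem_cut _ _ b hy').symm⟩
    · exact .inl ⟨fun a b => (EqFam.mem_cut _ _ a hy).trans (EqFam.mem_cut _ _ b hy).symm⟩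
  obtain ⟨A, A', rfl⟩ := exists_eq_cls_sub_cls a
  obtain ⟨B, B', rfl⟩ := exists_eq_cls_sub_cls b
  simp only [map_sub, sub_mul, mul_sub, key, sub_zero]

theorem rankCut_add_rankCut_compl (N : Set ℕ) (a : IncAlg k W P) :
    rankCut r N a + rankCut r Nᶜ a = a := by
  refine ext_comp fun p => ?_
  rw [map_add]
  by_cases h : r.r p ∈ N
  · rw [comp_rankCut_of_mem r h, comp_rankCut_of_notMem r (N := Nᶜ) (fun h' => h' h), add_zero]
  · rw [comp_rankCut_of_notMem r h, comp_rankCut_of_mem r (N := Nᶜ) h, zero_add]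

theorem rankCut_univ (a : IncAlg k W P) : rankCut r Set.univ a = a :=
  ext_comp fun _ => comp_rankCut_of_mem r (Set.mem_univ _) a

/-- The part of an element supported on the intervals of rank `m`. -/
def rankPart (m : ℕ) : IncAlg k W P →+ IncAlg k W P := rankCut r {m}

theorem comp_rankPart (m : ℕ) (p : Intv P) (a : IncAlg k W P) :
    comp p (rankPart r m a) = if r.r p = m then comp p a else 0 := by
  split_ifs with h
  · exact comp_rankCut_of_mem r h a
  · exact comp_rankCut_of_notMem r h a

theorem rankPart_rankPart (m n : ℕ) (a : IncAlg k W P) :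
    rankPart r m (rankPart r n a) = if m = n then rankPart r n a else 0 := by
  refine ext_comp fun p => ?_
  split_ifs with h
  · subst h
    rw [comp_rankPart, comp_rankPart]
    split_ifs <;> rfl
  · rw [comp_rankPart, comp_rankPart, map_zero, ite_eq_right_iff]
    exact fun e => if_neg (e ▸ h)

theorem ext_rankPart {a b : IncAlg k W P} (h : ∀ m, rankPart r m a = rankPart r m b) : a = b :=
  ext_comp fun p => by
    have := congrArg (comp p) (h (r.r p))
    rwa [comp_rankPart, comp_rankPart, if_pos rfl, if_pos rfl] at this

theorem exists_rankPart_eq (a : ℕ → IncAlg k W P) :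
    ∃ b : IncAlg k W P, ∀ m, rankPart r m b = rankPart r m (a m) := by
  obtain ⟨b, hb⟩ := K0.exists_glue r.r r.inv a
  refine ⟨b, fun m => ext_comp fun p => ?_⟩
  rw [comp_rankPart, comp_rankPart]
  split_ifs with h
  · subst h
    exact hb p _ _
  · rfl

omit [LocallyFiniteOrder P] in
theorem _root_.WeakRank.eq_zero_iff {r : WeakRank W P} {p : Intv P} : r.r p = 0 ↔ p.lo = p.hi := by
  constructor
  · intro h
    by_contra hne
    exact (r.pos p (lt_of_le_of_ne p.le hne)).ne' h
  · rcases p with ⟨x, y, h⟩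
    intro (e : x = y)
    subst e
    have := r.add (le_refl x) (le_refl x)
    change r.r ⟨x, x, h⟩ + r.r ⟨x, x, h⟩ = r.r ⟨x, x, h⟩ at this
    omega

theorem rankPart_one (m : ℕ) :
    rankPart r m (1 : IncAlg k W P) = if m = 0 then 1 else 0 := by
  have h1 : ∀ p : Intv P, r.r p ≠ 0 → comp p (1 : IncAlg k W P) = 0 := fun p hp =>
    K0.fiber_cls_eq_zero p _ _ (by
      have : IsEmpty (ULift.{v} (PLift (p.lo = p.hi))) :=
        ⟨fun e => hp (WeakRank.eq_zero_iff.2 e.down.down)⟩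
      exact inferInstanceAs (Subsingleton (ULift.{v} (PLift (p.lo = p.hi)) → k)))
  refine ext_comp fun p => ?_
  rw [comp_rankPart]
  by_cases hm : m = 0
  · subst hm
    by_cases hp : r.r p = 0
    · rw [if_pos hp, if_pos rfl]
    · rw [if_neg hp, if_pos rfl, h1 p hp]
  · rw [if_neg hm, map_zero]
    split_ifs with hp
    · exact h1 p (hp ▸ hm)
    · rfl

theorem comp_rankPart_mul {m n : ℕ} {p : Intv P} (h : m + n = r.r p) (a b : IncAlg k W P) :
    comp p (rankPart r m a * b) = comp p (rankPart r m a * rankPart r n b) := by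
  have hb := rankCut_add_rankCut_compl r {n} b
  conv_lhs => rw [← hb, mul_add, map_add]
  refine add_eq_left.2 (comp_rankCut_mul_rankCut_eq_zero r ?_ a b)
  rintro _ rfl n' hn' e
  exact hn' (show n' = n by omega)

/-- An element may have infinitely many nonzero rank parts, so it is the sum of finitely many of
them only up to a tail. -/
theorem eq_sum_rankPart_add_rankCut (n : ℕ) (a : IncAlg k W P) :
    a = ∑ i ∈ Finset.range (n + 1), rankPart r i a + rankCut r (Set.Ioi n) a := by
  refine ext_comp fun p => ?_
  simp only [map_add, map_sum, comp_rankPart, Finset.sum_ite_eq, Finset.mem_range]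
  by_cases hp : n < r.r p
  · rw [if_neg (by omega), zero_add, comp_rankCut_of_mem r (N := Set.Ioi n) hp]
  · rw [if_pos (by omega), comp_rankCut_of_notMem r (N := Set.Ioi n) hp, add_zero]

/-- The incidence algebra is graded by rank. -/
theorem rankPart_mul (m : ℕ) (a b : IncAlg k W P) :
    rankPart r m (a * b) = ∑ ij ∈ Finset.HasAntidiagonal.antidiagonal m, rankPart r ij.1 a * rankPart r ij.2 b := by
  refine ext_comp fun p => ?_
  rw [comp_rankPart, map_sum]
  split_ifs with hp
  -- The tail of `a` in ranks above `m` cannot contribute to an interval of rank `m`, whatever the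
  -- rank of the other factor.
  · have h0 : comp p (rankCut r (Set.Ioi m) a * b) = 0 := by
      rw [← rankCut_univ r b]
      refine comp_rankCut_mul_rankCut_eq_zero r (fun i hi j _ => ?_) a b
      rw [Set.mem_Ioi] at hi
      omega
    conv_lhs => rw [eq_sum_rankPart_add_rankCut r m a, add_mul, map_add, h0, add_zero,
      Finset.sum_mul, map_sum]
    rw [Finset.Nat.sum_antidiagonal_eq_sum_range_succ
      (fun i j => comp p (rankPart r i a * rankPart r j b))]
    refine Finset.sum_congr rfl fun i hi => comp_rankPart_mul r ?_ a b
    have := Finset.mem_range.1 hi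
    omega
  · refine (Finset.sum_eq_zero fun ij hij => ?_).symm
    refine comp_rankCut_mul_rankCut_eq_zero r ?_ a b
    rintro _ rfl _ rfl e
    exact hp (e.symm.trans (Finset.HasAntidiagonal.mem_antidiagonal.1 hij))

end IncAlg

/-! ### The Kazhdan-Lusztig-Stanley recursion in an abstract ring -/

/-- The sequence defined by a recursion in which `step G m` may use the values `G j`, `j < m`. -/
def recSeq {α : Type*} [Zero α] (step : (ℕ → α) → ℕ → α) (m : ℕ) : α :=
  -- Values at `j ≥ m` are replaced by 0. A convolution over `i + j = m` thereby loses exactly its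
  -- term `j = m`.
  step (fun j => if _h : j < m then recSeq step j else 0) m
termination_by m

/-- The data of Kazhdan-Lusztig-Stanley theory in the pieces of a graded ring: `D m` are the
elements of rank `m`, `H m` those of degree less than `m / 2`, and `rev m` is the reversal of
coefficients. -/
structure KLSData (Q : Type*) [Ring Q] where
  D : ℕ → AddSubgroup Q
  H : ℕ → AddSubgroup Q
  rev : ℕ → Q →+ Q
  H_le : ∀ m, H m ≤ D m
  one_mem : 1 ∈ D 0
  mul_mem : ∀ {i j a b}, a ∈ D i → b ∈ D j → a * b ∈ D (i + j)
  rev_one : rev 0 1 = 1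
  rev_mul : ∀ {i j a b}, a ∈ D i → b ∈ D j → rev (i + j) (a * b) = rev i a * rev j b
  exists_half : ∀ {m q}, 0 < m → q ∈ D m → rev m q = -q → ∃ h ∈ H m, rev m h - h = q
  half_eq_zero : ∀ {m h}, 0 < m → h ∈ H m → rev m h = h → h = 0

namespace KLSData

variable {Q : Type*} [Ring Q]

open MulOpposite in
/-- The same data for the opposite ring. -/
def op (S : KLSData Q) : KLSData Qᵐᵒᵖ where
  D m := (S.D m).comap (opAddEquiv (α := Q)).symm.toAddMonoidHom
  H m := (S.H m).comap (opAddEquiv (α := Q)).symm.toAddMonoidHom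
  rev m := (opAddEquiv (α := Q)).toAddMonoidHom.comp
    ((S.rev m).comp (opAddEquiv (α := Q)).symm.toAddMonoidHom)
  H_le m _ h := S.H_le m h
  one_mem := S.one_mem
  mul_mem {i j _ _} ha hb := add_comm i j ▸ S.mul_mem hb ha
  rev_one := congrArg MulOpposite.op S.rev_one
  rev_mul {i j _ _} ha hb := by
    rw [add_comm i j]
    exact congrArg MulOpposite.op (S.rev_mul hb ha)
  exists_half hm hq hr := by
    obtain ⟨h, hh, e⟩ := S.exists_half hm hq (congrArg MulOpposite.unop hr)
    exact ⟨MulOpposite.op h, hh, congrArg MulOpposite.op e⟩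
  half_eq_zero hm hh e :=
    MulOpposite.unop_injective (S.half_eq_zero hm hh (congrArg MulOpposite.unop e))

open Finset.HasAntidiagonal

variable (S : KLSData Q) {κ : ℕ → Q}

/-- Since `κ 0 = 1`, the only term involving `F m` is `F m` itself. This turns the equation in rank
`m` into `rev (F m) - F m = q` with `q` depending on lower ranks. -/
theorem sum_antidiagonal_mul_eq (h0 : κ 0 = 1) (F : ℕ → Q) (m : ℕ) :
    ∑ ij ∈ antidiagonal m, κ ij.1 * F ij.2 =
      ∑ ij ∈ antidiagonal m, κ ij.1 * (if ij.2 < m then F ij.2 else 0) + F m := by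
  have h : F m = ∑ ij ∈ antidiagonal m, if ij = (0, m) then F m else 0 := by
    rw [Finset.sum_ite_eq' (antidiagonal m), if_pos (mem_antidiagonal.2 (zero_add m))]
  conv_rhs => rw [h, ← Finset.sum_add_distrib]
  refine Finset.sum_congr rfl fun ij hij => ?_
  obtain ⟨i, j⟩ := ij
  have hij := mem_antidiagonal.1 hij
  dsimp only at hij ⊢
  by_cases hj : j < m
  · rw [if_pos hj, if_neg (fun e => hj.ne (Prod.ext_iff.1 e).2), add_zero]
  · obtain rfl : i = 0 := by omega
    obtain rfl : j = m := by omega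
    rw [if_neg hj, if_pos rfl, h0, mul_zero, one_mul, zero_add]

/-- Let `G` be `F` cut off below `m` and let `q` be the sum in question. Then `κ G` has the terms
`rev (F j)` for `j < m` and `q` in rank `m`. Multiplying by the inverse `rev κ` gives back `G`,
which is 0 in rank `m`. That rank reads `rev q + q = 0`: the terms with `j < m` make up `rev q`, and
the last one is `q`. -/
theorem rev_sum_eq_neg (hκ : ∀ m, κ m ∈ S.D m) (h0 : κ 0 = 1)
    (hinv : ∀ m, ∑ ij ∈ antidiagonal m, S.rev ij.1 (κ ij.1) * κ ij.2 = if m = 0 then 1 else 0)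
    {F : ℕ → Q} {m : ℕ} (hF : ∀ j < m, F j ∈ S.D j)
    (hFκ : ∀ j < m, S.rev j (F j) = ∑ ij ∈ antidiagonal j, κ ij.1 * F ij.2) :
    S.rev m (∑ ij ∈ antidiagonal m, κ ij.1 * (if ij.2 < m then F ij.2 else 0)) =
      -∑ ij ∈ antidiagonal m, κ ij.1 * (if ij.2 < m then F ij.2 else 0) := by
  set G : ℕ → Q := fun j => if j < m then F j else 0 with hG
  set q := ∑ ij ∈ antidiagonal m, κ ij.1 * (if ij.2 < m then F ij.2 else 0) with hq
  have hGD : ∀ j, G j ∈ S.D j := fun j => by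
    by_cases hj : j < m
    · simpa only [hG, if_pos hj] using hF j hj
    · simpa only [hG, if_neg hj] using zero_mem _
  -- The variable of these auxiliary power series over `Q` records the rank; they serve to make
  -- convolution associative.
  have hK : PowerSeries.mk (fun i => S.rev i (κ i)) * PowerSeries.mk κ = 1 := by
    ext m
    simp only [PowerSeries.coeff_mul, PowerSeries.coeff_mk, PowerSeries.coeff_one]
    exact hinv m
  have hlow : ∀ j < m, PowerSeries.coeff j (PowerSeries.mk κ * PowerSeries.mk G) =
      S.rev j (G j) := fun j hj => by
    simp only [PowerSeries.coeff_mul, PowerSeries.coeff_mk, hG]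
    rw [if_pos hj, hFκ j hj]
    refine Finset.sum_congr rfl fun ij hij => ?_
    have := mem_antidiagonal.1 hij
    rw [if_pos (by omega)]
  have hm : PowerSeries.coeff m (PowerSeries.mk κ * PowerSeries.mk G) = q := by
    simp only [PowerSeries.coeff_mul, PowerSeries.coeff_mk, hG, hq]
  have key : PowerSeries.coeff m (PowerSeries.mk (fun i => S.rev i (κ i)) *
      (PowerSeries.mk κ * PowerSeries.mk G)) = 0 := by
    rw [← mul_assoc, hK, one_mul, PowerSeries.coeff_mk, hG]
    exact if_neg (lt_irrefl m)
  rw [PowerSeries.coeff_mul] at key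
  have hrev : S.rev m q = ∑ ij ∈ antidiagonal m, S.rev ij.1 (κ ij.1) * S.rev ij.2 (G ij.2) := by
    rw [hq, map_sum]
    refine Finset.sum_congr rfl fun ij hij => ?_
    rw [← S.rev_mul (hκ _) (hGD _), mem_antidiagonal.1 hij]
  have hqs : q = ∑ ij ∈ antidiagonal m, if ij = (0, m) then q else 0 := by
    rw [Finset.sum_ite_eq' (antidiagonal m), if_pos (mem_antidiagonal.2 (zero_add m))]
  rw [eq_neg_iff_add_eq_zero, ← key, hrev]
  conv_lhs => rw [hqs, ← Finset.sum_add_distrib]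
  refine Finset.sum_congr rfl fun ij hij => ?_
  obtain ⟨i, j⟩ := ij
  have hij := mem_antidiagonal.1 hij
  dsimp only at hij ⊢
  rw [PowerSeries.coeff_mk]
  by_cases hj : j < m
  · rw [if_neg (fun e => hj.ne (Prod.ext_iff.1 e).2), add_zero, hlow j hj]
  · obtain rfl : i = 0 := by omega
    obtain rfl : j = m := by omega
    rw [if_pos rfl, hm, h0, S.rev_one, one_mul, hG, one_mul]
    simp

/-- Existence and uniqueness of the Kazhdan-Lusztig-Stanley sequence of a kernel. -/
theorem existsUnique (hκ : ∀ m, κ m ∈ S.D m) (h0 : κ 0 = 1)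
    (hinv : ∀ m, ∑ ij ∈ antidiagonal m, S.rev ij.1 (κ ij.1) * κ ij.2 = if m = 0 then 1 else 0) :
    ∃! F : ℕ → Q, F 0 = 1 ∧ (∀ m, 0 < m → F m ∈ S.H m) ∧
      ∀ m, S.rev m (F m) = ∑ ij ∈ antidiagonal m, κ ij.1 * F ij.2 := by
  classical
  -- The final default 0 is never used along the recursion: `rev_sum_eq_neg` and `exists_half`
  -- supply the required `h` in every positive rank.
  let step : (ℕ → Q) → ℕ → Q := fun G m =>
    if m = 0 then 1 else
      if h : ∃ h ∈ S.H m, S.rev m h - h = ∑ ij ∈ antidiagonal m, κ ij.1 * G ij.2 then h.choose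
      else 0
  let F := recSeq step
  have hF0 : F 0 = 1 := by
    change recSeq step 0 = 1
    rw [recSeq]
    exact if_pos rfl
  have hF : ∀ m, 0 < m → (∃ h ∈ S.H m, S.rev m h - h =
      ∑ ij ∈ antidiagonal m, κ ij.1 * (if ij.2 < m then F ij.2 else 0)) →
      F m ∈ S.H m ∧ S.rev m (F m) - F m =
        ∑ ij ∈ antidiagonal m, κ ij.1 * (if ij.2 < m then F ij.2 else 0) := by
    intro m hm h
    have e : F m = h.choose := by
      change recSeq step m = _
      rw [recSeq]
      exact (if_neg hm.ne').trans (dif_pos h)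
    rw [e]
    exact h.choose_spec
  have main : ∀ m, F m ∈ S.D m ∧ (0 < m → F m ∈ S.H m) ∧
      S.rev m (F m) = ∑ ij ∈ antidiagonal m, κ ij.1 * F ij.2 := by
    intro m
    induction m using Nat.strong_induction_on with
    | _ m ih =>
    rcases Nat.eq_zero_or_pos m with rfl | hm
    · refine ⟨hF0 ▸ S.one_mem, fun h => absurd h (lt_irrefl 0), ?_⟩
      have : antidiagonal 0 = {((0, 0) : ℕ × ℕ)} := rfl
      rw [this, Finset.sum_singleton, hF0, h0, S.rev_one, one_mul]
    · have hq := S.rev_sum_eq_neg hκ h0 hinv (fun j hj => (ih j hj).1) fun j hj => (ih j hj).2.2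
      obtain ⟨h₁, h₂⟩ := hF m hm (S.exists_half hm (sum_mem fun ij hij => by
        rw [← mem_antidiagonal.1 hij]
        refine S.mul_mem (hκ _) ?_
        split_ifs with hj
        · exact (ih _ (by rwa [← mem_antidiagonal.1 hij])).1
        · exact zero_mem _) hq)
      refine ⟨S.H_le m h₁, fun _ => h₁, ?_⟩
      rw [sum_antidiagonal_mul_eq h0, ← h₂, sub_add_cancel]
  refine ⟨F, ⟨hF0, fun m => (main m).2.1, fun m => (main m).2.2⟩, ?_⟩
  rintro F' ⟨h0', hH', hrev'⟩
  funext m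
  induction m using Nat.strong_induction_on with
  | _ m ih =>
  rcases Nat.eq_zero_or_pos m with rfl | hm
  · rw [h0', hF0]
  · rw [← sub_eq_zero]
    -- Two solutions that agree in lower ranks have the same `q`, so their difference is fixed by
    -- `rev` and lies in `H m`.
    refine S.half_eq_zero hm (sub_mem (hH' m hm) ((main m).2.1 hm)) ?_
    rw [map_sub, hrev', (main m).2.2, sum_antidiagonal_mul_eq h0, sum_antidiagonal_mul_eq h0 F,
      Finset.sum_congr rfl fun ij _ => ?_, add_sub_add_left_eq_sub]
    split_ifs with hj
    · rw [ih _ hj]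
    · rfl

end KLSData

/-! ### Reversal of coefficients -/

namespace PowerSeries

variable {R : Type*} [Ring R]

/-- Reversal of the coefficients of a polynomial of degree at most `m`. -/
def reversal (m : ℕ) : PowerSeries R →+ PowerSeries R where
  toFun f := mk fun n => if n ≤ m then coeff (m - n) f else 0
  map_zero' := by ext n; simp
  map_add' f g := by
    ext n
    simp only [coeff_mk, map_add]
    split_ifs <;> simp

theorem coeff_reversal (m n : ℕ) (f : PowerSeries R) :
    coeff n (reversal m f) = if n ≤ m then coeff (m - n) f else 0 := by
  simp [reversal]

open Finset.HasAntidiagonal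

/-- This is `t^(i+j) (fg)(t⁻¹) = t^i f(t⁻¹) · t^j g(t⁻¹)`. On both sides only pairs of exponents
`(a, b)` with `a ≤ i`, `b ≤ j` matter, and `(a, b) ↦ (i - a, j - b)` matches them. -/
theorem reversal_mul {i j : ℕ} {f g : PowerSeries R} (hf : ∀ n, i < n → coeff n f = 0)
    (hg : ∀ n, j < n → coeff n g = 0) :
    reversal (i + j) (f * g) = reversal i f * reversal j g := by
  ext n
  rw [coeff_reversal, coeff_mul, coeff_mul]
  simp only [coeff_reversal]
  split_ifs with hn
  · rw [← Finset.sum_filter_of_ne (p := fun x : ℕ × ℕ => x.1 ≤ i ∧ x.2 ≤ j),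
      ← Finset.sum_filter_of_ne (s := antidiagonal n) (p := fun x : ℕ × ℕ => x.1 ≤ i ∧ x.2 ≤ j)]
    · refine Finset.sum_nbij' (fun x => (i - x.1, j - x.2)) (fun x => (i - x.1, j - x.2))
        ?_ ?_ ?_ ?_ ?_
      all_goals
        rintro ⟨a, b⟩ hx
        obtain ⟨h, ha, hb⟩ := Finset.mem_filter.1 hx
        have h := mem_antidiagonal.1 h
        dsimp only at h ha hb ⊢
      · exact Finset.mem_filter.2 ⟨mem_antidiagonal.2 (by dsimp only; omega), by dsimp only; omega⟩
      · exact Finset.mem_filter.2 ⟨mem_antidiagonal.2 (by dsimp only; omega), by dsimp only; omega⟩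
      · rw [Nat.sub_sub_self ha, Nat.sub_sub_self hb]
      · rw [Nat.sub_sub_self ha, Nat.sub_sub_self hb]
      · rw [if_pos (Nat.sub_le _ _), if_pos (Nat.sub_le _ _), Nat.sub_sub_self ha,
          Nat.sub_sub_self hb]
    · intro x _ hx
      by_contra hx'
      refine hx ?_
      rcases not_and_or.1 hx' with h | h
      · rw [if_neg h, zero_mul]
      · rw [if_neg h, mul_zero]
    · intro x _ hx
      by_contra hx'
      refine hx ?_
      rcases not_and_or.1 hx' with h | h
      · rw [hf _ (not_le.1 h), zero_mul]
      · rw [hg _ (not_le.1 h), mul_zero]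
  · refine (Finset.sum_eq_zero fun x hx => ?_).symm
    have := mem_antidiagonal.1 hx
    by_cases h : x.1 ≤ i
    · rw [if_neg (show ¬ x.2 ≤ j by omega), mul_zero]
    · rw [if_neg h, zero_mul]

end PowerSeries

/-! ### The recursion applied to power series over the incidence algebra -/

open PowerSeries Finset.HasAntidiagonal

variable {k W P : Type*} [Field k] [Group W] [PartialOrder P] [PosetAction W P]
  [LocallyFiniteOrder P] (r : WeakRank W P)

/-- The part of a power series over the incidence algebra supported on intervals of rank `m`. -/
def seriesPart (m : ℕ) : PowerSeries (IncAlg k W P) →+ PowerSeries (IncAlg k W P) where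
  toFun f := mk fun n => IncAlg.rankPart r m (coeff n f)
  map_zero' := by ext n; simp
  map_add' f g := by ext n; simp

theorem coeff_seriesPart (m n : ℕ) (f : PowerSeries (IncAlg k W P)) :
    coeff n (seriesPart r m f) = IncAlg.rankPart r m (coeff n f) := by
  simp [seriesPart]

theorem seriesPart_mul (m : ℕ) (f g : PowerSeries (IncAlg k W P)) :
    seriesPart r m (f * g) =
      ∑ ij ∈ antidiagonal m, seriesPart r ij.1 f * seriesPart r ij.2 g := by
  ext n
  simp only [coeff_seriesPart, coeff_mul, map_sum, IncAlg.rankPart_mul]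
  exact Finset.sum_comm

theorem seriesPart_one (m : ℕ) :
    seriesPart r m (1 : PowerSeries (IncAlg k W P)) = if m = 0 then 1 else 0 := by
  ext n
  rw [coeff_seriesPart, coeff_one]
  by_cases hm : m = 0
  · rw [if_pos hm, coeff_one]
    split_ifs with hn
    · rw [IncAlg.rankPart_one, if_pos hm]
    · rw [map_zero]
  · rw [if_neg hm, map_zero]
    split_ifs with hn
    · rw [IncAlg.rankPart_one, if_neg hm]
    · rw [map_zero]

theorem ext_seriesPart {f g : PowerSeries (IncAlg k W P)}
    (h : ∀ m, seriesPart r m f = seriesPart r m g) : f = g := by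
  ext n
  refine IncAlg.ext_rankPart r fun m => ?_
  rw [← coeff_seriesPart, h, coeff_seriesPart]

/-- Gluing is done separately for each power of `t`. No bound on the degrees of the `F m` is needed,
since the result is only required to be a power series. -/
theorem exists_seriesPart_eq {F : ℕ → PowerSeries (IncAlg k W P)}
    (hF : ∀ m n, IncAlg.rankPart r m (coeff n (F m)) = coeff n (F m)) :
    ∃ f, ∀ m, seriesPart r m f = F m := by
  choose b hb using fun n => IncAlg.exists_rankPart_eq r fun m => coeff n (F m)
  refine ⟨mk b, fun m => ?_⟩
  ext n
  rw [coeff_seriesPart, coeff_mk, hb, hF]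

theorem coeffAt_eq_comp_seriesPart (f : PowerSeries (IncAlg k W P)) (p : Intv P) (n : ℕ) :
    coeffAt f p n = IncAlg.comp p (coeff n (seriesPart r (r.r p) f)) := by
  rw [coeff_seriesPart, IncAlg.comp_rankPart, if_pos rfl]
  rfl

theorem coeff_seriesPart_eq_zero_iff {f : PowerSeries (IncAlg k W P)} {m n : ℕ} :
    coeff n (seriesPart r m f) = 0 ↔ ∀ p, r.r p = m → coeffAt f p n = 0 := by
  constructor
  · rintro h p rfl
    rw [coeffAt_eq_comp_seriesPart r, h, map_zero]
  · intro h
    refine IncAlg.eq_zero_of_comp_eq_zero fun p => ?_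
    rw [coeff_seriesPart, IncAlg.comp_rankPart]
    split_ifs with hp
    · exact h p hp
    · rfl

variable (k) in
/-- The data of Kazhdan-Lusztig-Stanley theory in `I^W(P)⟦t⟧`. -/
def kLSData : KLSData (PowerSeries (IncAlg k W P)) where
  D m :=
    { carrier := {f | ∀ n, IncAlg.rankPart r m (coeff n f) = coeff n f ∧ (m < n → coeff n f = 0)}
      zero_mem' := fun n => by simp
      add_mem' := fun {f g} hf hg n => ⟨by rw [map_add, map_add, (hf n).1, (hg n).1],
        fun h => by rw [map_add, (hf n).2 h, (hg n).2 h, add_zero]⟩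
      neg_mem' := fun {f} hf n => ⟨by rw [map_neg, map_neg, (hf n).1],
        fun h => by rw [map_neg, (hf n).2 h, neg_zero]⟩ }
  H m :=
    { carrier := {f | ∀ n, IncAlg.rankPart r m (coeff n f) = coeff n f ∧
        (m ≤ 2 * n → coeff n f = 0)}
      zero_mem' := fun n => by simp
      add_mem' := fun {f g} hf hg n => ⟨by rw [map_add, map_add, (hf n).1, (hg n).1],
        fun h => by rw [map_add, (hf n).2 h, (hg n).2 h, add_zero]⟩
      neg_mem' := fun {f} hf n => ⟨by rw [map_neg, map_neg, (hf n).1],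
        fun h => by rw [map_neg, (hf n).2 h, neg_zero]⟩ }
  rev m := reversal m
  H_le m f hf n := ⟨(hf n).1, fun h => (hf n).2 (by omega)⟩
  one_mem n := by
    rw [← coeff_seriesPart, seriesPart_one, if_pos rfl]
    exact ⟨rfl, fun h => by rw [coeff_one, if_neg h.ne']⟩
  mul_mem {i j f g} hf hg n := by
    constructor
    · rw [coeff_mul, map_sum]
      refine Finset.sum_congr rfl fun x _ => ?_
      rw [← (hf x.1).1, ← (hg x.2).1, IncAlg.rankPart_mul, Finset.sum_eq_single (i, j)]
      · rw [IncAlg.rankPart_rankPart, if_pos rfl, IncAlg.rankPart_rankPart, if_pos rfl]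
      · intro y hy hne
        rw [IncAlg.rankPart_rankPart, IncAlg.rankPart_rankPart]
        by_cases h : y.1 = i
        · have hy := mem_antidiagonal.1 hy
          rw [if_neg (fun h' : y.2 = j => hne (Prod.ext h h')), mul_zero]
        · rw [if_neg h, zero_mul]
      · exact fun h => absurd (mem_antidiagonal.2 (show i + j = i + j from rfl)) h
    · intro h
      rw [coeff_mul]
      refine Finset.sum_eq_zero fun x hx => ?_
      have hx := mem_antidiagonal.1 hx
      by_cases hi : i < x.1
      · rw [(hf _).2 hi, zero_mul]
      · rw [(hg _).2 (by omega), mul_zero]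
  rev_one := by
    ext n
    rw [coeff_reversal, coeff_one, coeff_one]
    split_ifs <;> first | rfl | omega
  rev_mul hf hg := reversal_mul (fun n => (hf n).2) fun n => (hg n).2
  exists_half {m q} hm hq hr := by
    have hr' : ∀ n ≤ m, coeff (m - n) q = -coeff n q := fun n hn => by
      have := congrArg (coeff n) hr
      rwa [coeff_reversal, if_pos hn, map_neg] at this
    -- Take `h` to be minus the lower half of `q`. Then `-h` restores the lower half, and the
    -- reversal of `h` is the upper half by antisymmetry.
    refine ⟨mk fun n => if 2 * n < m then -coeff n q else 0, fun n => ?_, ?_⟩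
    · rw [coeff_mk]
      constructor
      · split_ifs with h
        · rw [map_neg, (hq n).1]
        · rw [map_zero]
      · exact fun h => if_neg (by omega)
    · ext n
      rw [map_sub, coeff_reversal, coeff_mk, coeff_mk]
      by_cases hn : n ≤ m
      · rw [if_pos hn]
        rcases lt_trichotomy (2 * n) m with h | h | h
        · rw [if_neg (by omega), if_pos h, zero_sub, neg_neg]
        · rw [if_neg (by omega), if_neg (by omega), sub_zero]
          -- The middle coefficient is its own negative; this is where the absence of 2-torsion
          -- enters.
          refine (IncAlg.eq_zero_of_add_self ?_).symm
          have := hr' n hn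
          rw [show m - n = n by omega] at this
          exact eq_neg_iff_add_eq_zero.1 this
        · rw [if_pos (by omega), if_neg (by omega), sub_zero, hr' n hn, neg_neg]
      · rw [if_neg hn, if_neg (by omega), sub_zero, (hq n).2 (by omega)]
  half_eq_zero {m h} hm hh e := by
    ext n
    rw [map_zero]
    by_cases hn : m ≤ 2 * n
    · exact (hh n).2 hn
    -- For `2 * n < m` the reversed exponent `m - n` lies in the upper half, where `h` vanishes.
    · rw [← e, coeff_reversal, if_pos (by omega)]
      exact (hh _).2 (by omega)

theorem mem_D_iff {m : ℕ} {f : PowerSeries (IncAlg k W P)} : seriesPart r m f ∈ (kLSData k r).D m ↔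
    ∀ n, m < n → coeff n (seriesPart r m f) = 0 := by
  refine ⟨fun h n => (h n).2, fun h n => ⟨?_, h n⟩⟩
  rw [coeff_seriesPart, IncAlg.rankPart_rankPart, if_pos rfl]

theorem mem_H_iff {m : ℕ} {f : PowerSeries (IncAlg k W P)} : seriesPart r m f ∈ (kLSData k r).H m ↔
    ∀ n, m ≤ 2 * n → coeff n (seriesPart r m f) = 0 := by
  refine ⟨fun h n => (h n).2, fun h n => ⟨?_, h n⟩⟩
  rw [coeff_seriesPart, IncAlg.rankPart_rankPart, if_pos rfl]

/-- Intervals of rank 0 are exactly the `[x, x]`, and the unit lives in rank 0. -/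
theorem diagOne_iff {f : PowerSeries (IncAlg k W P)} : DiagOne f ↔ seriesPart r 0 f = 1 := by
  have h1 : seriesPart r 0 (1 : PowerSeries (IncAlg k W P)) = 1 := by
    rw [seriesPart_one, if_pos rfl]
  rw [← h1, ← sub_eq_zero, ← map_sub]
  constructor
  · intro h
    ext n
    rw [map_zero, coeff_seriesPart_eq_zero_iff]
    intro p hp
    obtain ⟨x, y, hxy⟩ := p
    obtain rfl : x = y := WeakRank.eq_zero_iff.1 hp
    exact (map_sub _ _ _).trans (sub_eq_zero.2 (h x n))
  · intro h x n
    have := (coeff_seriesPart_eq_zero_iff r (n := n)).1 (by rw [h, map_zero]) ⟨x, x, le_rfl⟩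
      (WeakRank.eq_zero_iff.2 rfl)
    exact sub_eq_zero.1 ((map_sub _ _ _).symm.trans this)

theorem mem_scriptI_iff {f : PowerSeries (IncAlg k W P)} :
    f ∈ scriptI r ↔ ∀ m, seriesPart r m f ∈ (kLSData k r).D m := by
  simp only [mem_D_iff, coeff_seriesPart_eq_zero_iff]
  exact ⟨fun h m n hn p hp => h p n (hp ▸ hn), fun h p n hn => h _ n hn p rfl⟩

theorem mem_scriptIHalf_iff {f : PowerSeries (IncAlg k W P)} :
    f ∈ scriptIHalf r ↔
      seriesPart r 0 f = 1 ∧ ∀ m, 0 < m → seriesPart r m f ∈ (kLSData k r).H m := by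
  simp only [mem_H_iff, coeff_seriesPart_eq_zero_iff, ← diagOne_iff]
  refine and_congr_right fun _ => ⟨fun h m hm n hn p hp => h p n ?_ (hp ▸ hn),
    fun h p n hp hn => h _ (r.pos p hp) n hn p rfl⟩
  refine lt_of_le_of_ne p.le fun e => ?_
  rw [WeakRank.eq_zero_iff.2 e] at hp
  exact hm.ne hp

theorem isBar_iff {f g : PowerSeries (IncAlg k W P)} :
    IsBar r f g ↔ ∀ m, reversal m (seriesPart r m f) = seriesPart r m g := by
  constructor
  · intro h m
    ext n
    refine IncAlg.ext_comp fun p => ?_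
    rw [coeff_reversal, coeff_seriesPart, coeff_seriesPart, IncAlg.comp_rankPart, apply_ite
      (IncAlg.comp p), map_zero, IncAlg.comp_rankPart]
    split_ifs with h₁ h₂ h₂
    · subst h₂
      exact ((h p n).trans (if_pos h₁)).symm
    · rfl
    · subst h₂
      exact ((h p n).trans (if_neg h₁)).symm
    · rfl
  · intro h p n
    rw [coeffAt_eq_comp_seriesPart r, coeffAt_eq_comp_seriesPart r, ← h, coeff_reversal]
    split_ifs with h₁
    · rfl
    · rw [map_zero]

theorem existsUnique_left {κ : PowerSeries (IncAlg k W P)} (hκ : IsPKernel r κ) :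
    ∃! f, f ∈ scriptIHalf r ∧ IsBar r f (κ * f) := by
  obtain ⟨hD, h1, κ', hbar, -, hinv⟩ := hκ
  rw [isBar_iff] at hbar
  obtain ⟨F, ⟨hF0, hFH, hF⟩, huniq⟩ := (kLSData k r).existsUnique ((mem_scriptI_iff r).1 hD)
    -- The rank `m` part of `\bar κ κ = 1`, with `\bar κ` expressed by reversing each rank part of
    -- `κ`.
    ((diagOne_iff r).1 h1) fun m => by
      rw [← seriesPart_one r, ← hinv, seriesPart_mul]
      exact Finset.sum_congr rfl fun x _ => congrArg (· * _) (hbar x.1)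
  have hiff : ∀ f, (f ∈ scriptIHalf r ∧ IsBar r f (κ * f)) ↔ (fun m => seriesPart r m f) = F := by
    intro f
    rw [mem_scriptIHalf_iff, isBar_iff]
    simp only [seriesPart_mul]
    constructor
    · rintro ⟨⟨h0, hH⟩, hf⟩
      exact huniq _ ⟨h0, hH, hf⟩
    · rintro rfl
      exact ⟨⟨hF0, hFH⟩, hF⟩
  obtain ⟨f, hf⟩ := exists_seriesPart_eq r (F := F) fun m n => by
    rcases Nat.eq_zero_or_pos m with rfl | hm
    · rw [hF0]
      exact ((kLSData k r).one_mem n).1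
    · exact (hFH m hm n).1
  refine ⟨f, (hiff f).2 (funext hf), fun g hg => ext_seriesPart r fun m => ?_⟩
  rw [hf]
  exact congrFun ((hiff g).1 hg) m

open MulOpposite in
theorem existsUnique_right {κ : PowerSeries (IncAlg k W P)} (hκ : IsPKernel r κ) :
    ∃! g, g ∈ scriptIHalf r ∧ IsBar r g (g * κ) := by
  obtain ⟨hD, h1, κ', hbar, hinv, -⟩ := hκ
  rw [isBar_iff] at hbar
  obtain ⟨F, ⟨hF0, hFH, hF⟩, huniq⟩ := (kLSData k r).op.existsUnique
    (κ := fun m => op (seriesPart r m κ)) ((mem_scriptI_iff r).1 hD)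
    -- In the opposite ring the required left inverse relation comes from `κ \bar κ = 1`. The
    -- antidiagonal is swapped because the order of the factors is reversed.
    (congrArg op ((diagOne_iff r).1 h1)) fun m => by
      have : seriesPart r m (κ * κ') = _ := seriesPart_mul r m κ κ'
      rw [hinv, seriesPart_one, ← Finset.Nat.sum_antidiagonal_swap] at this
      refine Eq.trans ?_ ((congrArg op this).symm.trans (by split_ifs <;> rfl))
      rw [Finset.op_sum]
      exact Finset.sum_congr rfl fun x _ => congrArg (fun y => op (seriesPart r x.2 κ * y)) (hbar x.1)
  have hiff : ∀ g, (g ∈ scriptIHalf r ∧ IsBar r g (g * κ)) ↔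
      (fun m => op (seriesPart r m g)) = F := by
    intro g
    rw [mem_scriptIHalf_iff, isBar_iff]
    have e : ∀ m, reversal m (seriesPart r m g) = seriesPart r m (g * κ) ↔
        (kLSData k r).op.rev m (op (seriesPart r m g)) =
          ∑ x ∈ antidiagonal m, op (seriesPart r x.1 κ) * op (seriesPart r x.2 g) := by
      intro m
      rw [seriesPart_mul, ← Finset.Nat.sum_antidiagonal_swap, ← op_injective.eq_iff, Finset.op_sum]
      exact Iff.rfl
    simp only [e]
    constructor
    · rintro ⟨⟨h0, hH⟩, hf⟩
      exact huniq _ ⟨congrArg op h0, hH, hf⟩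
    · rintro rfl
      exact ⟨⟨op_injective hF0, hFH⟩, hF⟩
  obtain ⟨g, hg⟩ := exists_seriesPart_eq r (F := fun m => unop (F m)) fun m n => by
    rcases Nat.eq_zero_or_pos m with rfl | hm
    · rw [hF0]
      exact ((kLSData k r).one_mem n).1
    · exact (hFH m hm n).1
  refine ⟨g, (hiff g).2 (funext fun m => unop_injective (hg m)),
    fun g' hg' => ext_seriesPart r fun m => ?_⟩
  rw [hg]
  exact congrArg unop (congrFun ((hiff g').1 hg') m)

end

theorem mainTheorem1 {k : Type*} {W : Type*} {P : Type*} [Field k] [Group W] [Finite W]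
    [PartialOrder P] [LocallyFiniteOrder P] [PosetAction W P] (r : WeakRank W P)
    (κ : PowerSeries (IncAlg k W P)) (hκ : IsPKernel r κ) :
    ∃! fg : PowerSeries (IncAlg k W P) × PowerSeries (IncAlg k W P),
      (fg.1 ∈ scriptIHalf r ∧ fg.2 ∈ scriptIHalf r) ∧
        IsBar r fg.1 (κ * fg.1) ∧ IsBar r fg.2 (fg.2 * κ) := by
  obtain ⟨f, ⟨hf, hf'⟩, hf_unique⟩ := existsUnique_left r hκ
  obtain ⟨g, ⟨hg, hg'⟩, hg_unique⟩ := existsUnique_right r hκ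
  refine ⟨(f, g), ⟨⟨hf, hg⟩, hf', hg'⟩, ?_⟩
  rintro ⟨f₁, g₁⟩ ⟨⟨h₁, h₂⟩, h₃, h₄⟩
  exact Prod.ext (hf_unique f₁ ⟨h₁, h₃⟩) (hg_unique g₁ ⟨h₂, h₄⟩)
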